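/- Let $k$ be an algebraically closed field with $\mathrm{char}(k)\neq 2$. Let $D_4$ be the $k$-algebra generated by $a,b,c,d$ subject to the relations $$ba=-ab,\quad db=-bd,\quad ca=-ac,\quad dc=-cd,\quad bc=cb,$$ $$a^2=0,\quad b^2=1,\quad c^2=1,\quad d^2=0,\quad da+ad=1-bc,$$ with the comultiplication $\Delta(a)=a\otimes b+1\otimes a$, $\Delta(b)=b\otimes b$, $\Delta(c)=c\otimes c$, $\Delta(d)=d\otimes c+1\otimes d$ and the counit $\varepsilon(a)=\varepsilon(d)=0$, $\varepsilon(b)=\varepsilon(c)=1$ (this is the Drinfeld double of Sweedler's 4-dimensional Hopf algebra). All modules are finite-dimensional left $D_4$-modules, $\otimes$ is the tensor product over $k$, on which $D_4$ acts through $\Delta$, and $nM$ denotes the direct sum of $n$ copies of $M$. For $r\in\mathbb{Z}/2\mathbb{Z}$ let $V(r)$ be the one-dimensional module on which $a$ and $d$ act by $0$ and $b$ and $c$ act by $(-1)^r$, and let $P(r)$ be the projective cover of $V(r)$. For a module $M$ let $\Omega M$ be the kernel of its projective cover $P(M)\to M$ and let $\Omega^{-1}M$ be the cokernel of its injective envelope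 $M\to I(M)$; for $s\ge 1$ let $\Omega^{s}M$ and $\Omega^{-s}M$ be the $s$-fold iterates of $\Omega$ and $\Omega^{-1}$, and let $\Omega^0M=M$. Proposition 2.20. Let $r,r'\in\mathbb{Z}/2\mathbb{Z}$ and let $s,t\ge 1$ be integers. Then there are the following isomorphisms of $D_4$-modules. (1) If $s+t$ is even and $s\ge t$, then $\Omega^{s}V(r)\otimes\Omega^{-t}V(r')\cong\Omega^{s-t}V(r+r')\oplus(s+1)t\,P(r+r'+1)$. (2) If $s+t$ is odd and $s\ge t$, then $\Omega^{s}V(r)\otimes\Omega^{-t}V(r')\cong\Omega^{s-t}V(r+r')\oplus(s+1)t\,P(r+r')$. (3) If $s+t$ is even and $s<t$, then $\Omega^{s}V(r)\otimes\Omega^{-t}V(r')\cong\Omega^{s-t}V(r+r')\oplus(t+1)s\,P(r+r'+1)$. (4) If $s+t$ is odd and $s<t$, then $\Omega^{s}V(r)\otimes\Omega^{-t}V(r')\cong\Omega^{s-t}V(r+r')\oplus(t+1)s\,P(r+r')$. -/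

import Mathlib

open scoped TensorProduct

universe u

/-- The four generators of `D4`. -/
inductive D4Gen : Type
  | a | b | c | d

/-- The defining relations of `D4`. -/
inductive D4Rel (k : Type u) [Field k] : FreeAlgebra k D4Gen → FreeAlgebra k D4Gen → Prop
  | ba : D4Rel k (.ι k .b * .ι k .a) (-(.ι k .a * .ι k .b))
  | db : D4Rel k (.ι k .d * .ι k .b) (-(.ι k .b * .ι k .d))
  | ca : D4Rel k (.ι k .c * .ι k .a) (-(.ι k .a * .ι k .c))
  | dc : D4Rel k (.ι k .d * .ι k .c) (-(.ι k .c * .ι k .d))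
  | bc : D4Rel k (.ι k .b * .ι k .c) (.ι k .c * .ι k .b)
  | aa : D4Rel k (.ι k .a * .ι k .a) 0
  | bb : D4Rel k (.ι k .b * .ι k .b) 1
  | cc : D4Rel k (.ι k .c * .ι k .c) 1
  | dd : D4Rel k (.ι k .d * .ι k .d) 0
  | da : D4Rel k (.ι k .d * .ι k .a + .ι k .a * .ι k .d) (1 - .ι k .b * .ι k .c)

/-- The algebra `D4`, presented by generators and relations. -/
def D4 (k : Type u) [Field k] : Type u := RingQuot (D4Rel k)

namespace D4

variable (k : Type u) [Field k]

noncomputable instance : Ring (D4 k) := inferInstanceAs (Ring (RingQuot (D4Rel k)))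
noncomputable instance : Algebra k (D4 k) := inferInstanceAs (Algebra k (RingQuot (D4Rel k)))

/-- The quotient map from the free algebra. -/
noncomputable def mk : FreeAlgebra k D4Gen →ₐ[k] D4 k := RingQuot.mkAlgHom k (D4Rel k)

/-- The image of a generator in `D4`. -/
noncomputable def gen (x : D4Gen) : D4 k := mk k (FreeAlgebra.ι k x)

theorem mk_rel {x y : FreeAlgebra k D4Gen} (h : D4Rel k x y) : mk k x = mk k y :=
  RingQuot.mkAlgHom_rel k h

theorem rel_ba : gen k .b * gen k .a = -(gen k .a * gen k .b) := by
  simpa [gen] using mk_rel k (D4Rel.ba (k := k))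
theorem rel_db : gen k .d * gen k .b = -(gen k .b * gen k .d) := by
  simpa [gen] using mk_rel k (D4Rel.db (k := k))
theorem rel_ca : gen k .c * gen k .a = -(gen k .a * gen k .c) := by
  simpa [gen] using mk_rel k (D4Rel.ca (k := k))
theorem rel_dc : gen k .d * gen k .c = -(gen k .c * gen k .d) := by
  simpa [gen] using mk_rel k (D4Rel.dc (k := k))
theorem rel_bc : gen k .b * gen k .c = gen k .c * gen k .b := by
  simpa [gen] using mk_rel k (D4Rel.bc (k := k))
theorem rel_aa : gen k .a * gen k .a = 0 := by
  simpa [gen] using mk_rel k (D4Rel.aa (k := k))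
theorem rel_bb : gen k .b * gen k .b = 1 := by
  simpa [gen] using mk_rel k (D4Rel.bb (k := k))
theorem rel_cc : gen k .c * gen k .c = 1 := by
  simpa [gen] using mk_rel k (D4Rel.cc (k := k))
theorem rel_dd : gen k .d * gen k .d = 0 := by
  simpa [gen] using mk_rel k (D4Rel.dd (k := k))
theorem rel_da : gen k .d * gen k .a + gen k .a * gen k .d = 1 - gen k .b * gen k .c := by
  simpa [gen] using mk_rel k (D4Rel.da (k := k))

variable {k}

/-- The assignment of elements of an algebra `B` to the generators respects the relations. -/
structure Respects {B : Type*} [Ring B] (f : D4Gen → B) : Prop where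
  ba : f .b * f .a = -(f .a * f .b)
  db : f .d * f .b = -(f .b * f .d)
  ca : f .c * f .a = -(f .a * f .c)
  dc : f .d * f .c = -(f .c * f .d)
  bc : f .b * f .c = f .c * f .b
  aa : f .a * f .a = 0
  bb : f .b * f .b = 1
  cc : f .c * f .c = 1
  dd : f .d * f .d = 0
  da : f .d * f .a + f .a * f .d = 1 - f .b * f .c

/-- The universal property of `D4`. -/
noncomputable def lift {B : Type*} [Ring B] [Algebra k B] (f : D4Gen → B) (h : Respects f) :
    D4 k →ₐ[k] B :=
  RingQuot.liftAlgHom k ⟨FreeAlgebra.lift k f, by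
    intro x y hxy
    cases hxy <;> simp [h.ba, h.db, h.ca, h.dc, h.bc, h.aa, h.bb, h.cc, h.dd, h.da]⟩

@[simp] theorem lift_gen {B : Type*} [Ring B] [Algebra k B] (f : D4Gen → B) (h : Respects f)
    (x : D4Gen) : lift (k := k) f h (gen k x) = f x :=
  (RingQuot.liftAlgHom_mkAlgHom_apply k _ _ _).trans (by simp)

theorem algHom_ext {B : Type*} [Ring B] [Algebra k B] {f g : D4 k →ₐ[k] B}
    (h : ∀ x, f (gen k x) = g (gen k x)) : f = g := by
  apply RingQuot.ringQuot_ext'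
  apply FreeAlgebra.hom_ext
  funext x
  exact h x

variable (k)

/-- The values of the comultiplication on the generators. -/
noncomputable def comulGen : D4Gen → D4 k ⊗[k] D4 k
  | .a => gen k .a ⊗ₜ gen k .b + 1 ⊗ₜ gen k .a
  | .b => gen k .b ⊗ₜ gen k .b
  | .c => gen k .c ⊗ₜ gen k .c
  | .d => gen k .d ⊗ₜ gen k .c + 1 ⊗ₜ gen k .d

/-- The values of the counit on the generators. -/
def counitGen : D4Gen → k
  | .a => 0
  | .b => 1
  | .c => 1
  | .d => 0

theorem respects_counitGen : Respects (counitGen k) := by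
  constructor <;> simp [counitGen]

theorem respects_comulGen : Respects (comulGen k) := by
  have da : gen k .d * gen k .a = 1 - gen k .b * gen k .c - gen k .a * gen k .d := by
    rw [← rel_da]; abel
  constructor <;>
    simp only [comulGen, mul_add, add_mul, Algebra.TensorProduct.tmul_mul_tmul, rel_ba, rel_db,
      rel_ca, rel_dc, rel_bc, rel_aa, rel_bb, rel_cc, rel_dd, da, mul_one, one_mul,
      TensorProduct.neg_tmul, TensorProduct.tmul_neg, TensorProduct.sub_tmul,
      TensorProduct.tmul_sub, TensorProduct.zero_tmul, TensorProduct.tmul_zero,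
      Algebra.TensorProduct.one_def] <;> abel

/-- The bialgebra structure of `D4`. -/
noncomputable instance : Bialgebra k (D4 k) :=
  Bialgebra.ofAlgHom (lift (comulGen k) (respects_comulGen k))
    (lift (counitGen k) (respects_counitGen k))
    (by
      apply algHom_ext
      rintro (_ | _ | _ | _) <;>
        simp [comulGen, TensorProduct.add_tmul, TensorProduct.tmul_add,
          Algebra.TensorProduct.one_def, add_assoc])
    (by
      apply algHom_ext
      rintro (_ | _ | _ | _) <;> simp [comulGen, counitGen])
    (by
      apply algHom_ext
      rintro (_ | _ | _ | _) <;> simp [comulGen, counitGen])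

variable {k} in
/-- A subspace that contains `1` and is stable under left multiplication by the generators is
everything. -/
theorem eq_top_of_gen_mul_mem (S : Submodule k (D4 k)) (h1 : (1 : D4 k) ∈ S)
    (h : ∀ x, ∀ y ∈ S, gen k x * y ∈ S) : S = ⊤ := by
  have key : ∀ z : FreeAlgebra k D4Gen, ∀ y ∈ S, mk k z * y ∈ S := by
    intro z
    induction z using FreeAlgebra.induction with
    | grade0 r =>
      intro y hy
      rw [AlgHom.commutes, ← Algebra.smul_def]
      exact S.smul_mem r hy
    | grade1 x => exact h x
    | mul p q hp hq =>
      intro y hy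
      rw [map_mul, mul_assoc]
      exact hp _ (hq _ hy)
    | add p q hp hq =>
      intro y hy
      rw [map_add, add_mul]
      exact S.add_mem (hp _ hy) (hq _ hy)
  rw [eq_top_iff]
  intro z _
  obtain ⟨w, rfl⟩ : ∃ w, mk k w = z := RingQuot.mkAlgHom_surjective k (D4Rel k) z
  simpa using key w 1 h1

/-- The monomials `a^i b^j c^l d^m` with exponents `0` or `1`. -/
noncomputable def mono (e : Fin 2 × Fin 2 × Fin 2 × Fin 2) : D4 k :=
  gen k .a ^ (e.1 : ℕ) * (gen k .b ^ (e.2.1 : ℕ) * (gen k .c ^ (e.2.2.1 : ℕ) *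
    gen k .d ^ (e.2.2.2 : ℕ)))

theorem span_mono : Submodule.span k (Set.range (mono k)) = ⊤ := by
  have da : gen k .d * gen k .a = 1 - gen k .b * gen k .c - gen k .a * gen k .d := by
    rw [← rel_da]; abel
  have cb := (rel_bc k).symm
  have hm : ∀ e, mono k e ∈ Submodule.span k (Set.range (mono k)) :=
    fun e => Submodule.subset_span ⟨e, rfl⟩
  have H : ∀ {p q r : D4 k}, p * q = r → ∀ y, p * (q * y) = r * y := by
    intro p q r h y
    rw [← mul_assoc, h]
  apply eq_top_of_gen_mul_mem
  · simpa [mono] using hm (0, 0, 0, 0)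
  · intro x y hy
    induction hy using Submodule.span_induction with
    | zero => simp
    | add p q _ _ hp hq => rw [mul_add]; exact Submodule.add_mem _ hp hq
    | smul r p _ hp => rw [mul_smul_comm]; exact Submodule.smul_mem _ r hp
    | mem p hp =>
      obtain ⟨⟨i, j, l, m⟩, rfl⟩ := hp
      have h000 := hm (0, 0, 0, 0)
      have h := fun i j l m => hm (i, j, l, m)
      simp only [Fin.forall_fin_two] at h
      simp [mono] at h
      fin_cases i <;> fin_cases j <;> fin_cases l <;> fin_cases m <;> cases x <;>
        simp [mono, rel_ba, rel_db, rel_ca, rel_dc, cb, rel_aa, rel_bb, rel_cc, rel_dd, da,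
          H (rel_ba k), H (rel_db k), H (rel_ca k), H (rel_dc k), H cb, H (rel_aa k),
          H (rel_bb k), H (rel_cc k), H da, mul_assoc, sub_mul, h] <;>
        first
        | exact Submodule.sub_mem _ (by simp [h]) (by simp [h])
        | exact Submodule.sub_mem _ (Submodule.sub_mem _ (by simp [h]) (by simp [h])) (by simp [h])
        | exact Submodule.add_mem _ (Submodule.sub_mem _ (by simp [h]) (by simp [h])) (by simp [h])

instance : Module.Finite k (D4 k) :=
  ⟨⟨(Set.finite_range (mono k)).toFinset, by simpa using span_mono k⟩⟩

variable {k}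

/-- The finite dimensional `D4`-module given by a representation `ρ : D4 → End_k(W)` on a finite
dimensional vector space. -/
noncomputable def ofRep {W : Type u} [AddCommGroup W] [Module k W] [Module.Finite k W]
    (ρ : D4 k →ₐ[k] Module.End k W) : FGModuleCat.{u} (D4 k) :=
  letI : Module (D4 k) W := Module.compHom W ρ.toRingHom
  haveI : IsScalarTower k (D4 k) W := ⟨fun x y w => by
    change ρ (x • y) w = x • ρ y w
    rw [map_smul, LinearMap.smul_apply]⟩
  haveI : Module.Finite (D4 k) W := Module.Finite.of_restrictScalars_finite k (D4 k) W
  FGModuleCat.of (D4 k) W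

open scoped ModuleCat in
theorem finite_over_field (M : FGModuleCat.{u} (D4 k)) : Module.Finite k M :=
  Module.Finite.trans (D4 k) M

open scoped ModuleCat in
/-- The tensor product over `k` of two finite dimensional `D4`-modules, on which `D4` acts through
the comultiplication: `x • (m ⊗ n) = ∑ (x₁ • m) ⊗ (x₂ • n)`. -/
noncomputable def tensor (M N : FGModuleCat.{u} (D4 k)) : FGModuleCat.{u} (D4 k) :=
  haveI := finite_over_field M
  haveI := finite_over_field N
  ofRep (W := M ⊗[k] N)
    ((Module.endTensorEndAlgHom (R := k) (S := k) (A := k) (M := M) (N := N)).comp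
      ((Algebra.TensorProduct.map (Algebra.lsmul k k M) (Algebra.lsmul k k N)).comp
        (Bialgebra.comulAlgHom k (D4 k))))

variable (k)

/-- The scalars by which the generators act on `V(r)`: `a` and `d` act by `0`, `b` and `c` act by
`(-1)^r`. -/
def charGen (r : ZMod 2) : D4Gen → k
  | .a => 0
  | .b => (-1) ^ r.val
  | .c => (-1) ^ r.val
  | .d => 0

theorem respects_charGen (r : ZMod 2) : Respects (charGen k r) := by
  have h : (-1 : k) ^ r.val * (-1) ^ r.val = 1 := by
    rw [← mul_pow]; simp
  constructor <;> simp [charGen, h]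

/-- The one-dimensional simple module `V(r)`. -/
noncomputable def V (r : ZMod 2) : FGModuleCat.{u} (D4 k) :=
  ofRep (W := k) ((Algebra.lmul k k).comp (lift (charGen k r) (respects_charGen k r)))

end D4

section Covers

variable {A : Type u} [Ring A]

/-- `f : P → M` is a projective cover: `P` is projective, `f` is onto, and the kernel of `f` is
superfluous. -/
structure IsProjectiveCover {P M : Type u} [AddCommGroup P] [Module A P] [AddCommGroup M]
    [Module A M] (f : P →ₗ[A] M) : Prop where
  projective : Module.Projective A P
  surjective : Function.Surjective f
  superfluous : ∀ U : Submodule A P, U ⊔ LinearMap.ker f = ⊤ → U = ⊤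

/-- `f : M → I` is an injective envelope: `I` is injective, `f` is one-to-one, and the image of `f`
is an essential submodule. -/
structure IsInjectiveEnvelope {M I : Type u} [AddCommGroup M] [Module A M] [AddCommGroup I]
    [Module A I] (f : M →ₗ[A] I) : Prop where
  injective_module : Module.Injective A I
  injective : Function.Injective f
  essential : ∀ U : Submodule A I, U ⊓ LinearMap.range f = ⊥ → U = ⊥

theorem Module.Projective.of_isCompl {P : Type u} [AddCommGroup P] [Module A P]
    [Module.Projective A P] {U V : Submodule A P} (h : IsCompl U V) : Module.Projective A U :=
  Module.Projective.of_split U.subtype (Submodule.projectionOnto U V h) (by ext; simp)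

theorem Module.Injective.of_isCompl {P : Type u} [AddCommGroup P] [Module A P]
    [Module.Injective A P] {U V : Submodule A P} (h : IsCompl U V) : Module.Injective A U where
  out X Y _ _ _ _ f hf g := by
    obtain ⟨e, he⟩ := Module.Injective.out (Q := P) f hf (U.subtype ∘ₗ g)
    exact ⟨Submodule.projectionOnto U V h ∘ₗ e, fun x => by simp [he]⟩

theorem exists_isProjectiveCover [IsArtinianRing A]
    (M : FGModuleCat.{u} A) :
    ∃ (P : FGModuleCat.{u} A) (f : P →ₗ[A] M), IsProjectiveCover f := by
  obtain ⟨n, f, hf⟩ := Module.Finite.exists_fin' A M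
  let T : Set (Submodule A (Fin n → A)) :=
    {U | Module.Projective A U ∧ Submodule.map f U = ⊤}
  have hT : T.Nonempty := ⟨⊤, Module.Projective.of_equiv (Submodule.topEquiv (R := A)).symm, by
    rw [Submodule.map_top, LinearMap.range_eq_top.2 hf]⟩
  obtain ⟨U, ⟨hU, hUf⟩, hmin⟩ := wellFounded_lt.has_min T hT
  let p : U →ₗ[A] M := f ∘ₗ U.subtype
  have hp : Function.Surjective p := by
    rw [← LinearMap.range_eq_top, LinearMap.range_comp, Submodule.range_subtype, hUf]
  refine ⟨FGModuleCat.of A U, p, hU, hp, fun W hW => ?_⟩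
  have hpW : Function.Surjective (p ∘ₗ W.subtype) := by
    rw [← LinearMap.range_eq_top, LinearMap.range_comp, Submodule.range_subtype]
    have := congrArg (Submodule.map p) hW
    rwa [Submodule.map_sup, Submodule.map_top, LinearMap.range_eq_top.2 hp,
      (LinearMap.le_ker_iff_map (p := LinearMap.ker p)).1 le_rfl, sup_bot_eq] at this
  obtain ⟨g, hg⟩ := Module.projective_lifting_property (p ∘ₗ W.subtype) p hpW
  let φ : U →ₗ[A] U := W.subtype ∘ₗ g
  have hφ : p ∘ₗ φ = p := hg
  have hφn : ∀ n, p ∘ₗ (φ ^ n) = p := by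
    intro n
    induction n with
    | zero => rfl
    | succ n ih => rw [pow_succ', Module.End.mul_eq_comp, ← LinearMap.comp_assoc, hφ, ih]
  obtain ⟨n, hn, hn1⟩ := (φ.eventually_isCompl_ker_pow_range_pow.and
    (Filter.eventually_ge_atTop 1)).exists
  have hle : LinearMap.range (φ ^ n) ≤ W := by
    obtain ⟨m, rfl⟩ : ∃ m, n = m + 1 := ⟨n - 1, by omega⟩
    rw [pow_succ', Module.End.mul_eq_comp]
    refine (LinearMap.range_comp_le_range _ _).trans ?_
    exact (LinearMap.range_comp_le_range _ _).trans (by simp)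
  have hproj : Module.Projective A (LinearMap.range (φ ^ n)) :=
    Module.Projective.of_isCompl hn.symm
  have hmem : Submodule.map U.subtype (LinearMap.range (φ ^ n)) ∈ T := by
    refine ⟨Module.Projective.of_equiv
      (Submodule.equivMapOfInjective U.subtype U.injective_subtype _), ?_⟩
    rw [← Submodule.map_comp]
    change Submodule.map p _ = ⊤
    rw [← LinearMap.range_comp, hφn, LinearMap.range_eq_top.2 hp]
  have hnot := hmin _ hmem
  have hleU : Submodule.map U.subtype (LinearMap.range (φ ^ n)) ≤ U := Submodule.map_subtype_le _ _
  have heq := (hleU.lt_or_eq).resolve_left hnot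
  rw [eq_top_iff]
  refine le_trans ?_ hle
  rw [← Submodule.map_le_map_iff_of_injective U.injective_subtype, heq]
  simp

theorem Submodule.exists_isInjectiveEnvelope {M I : Type u} [AddCommGroup M] [Module A M]
    [AddCommGroup I] [Module A I] [IsNoetherian A I] [IsArtinian A I] [Module.Injective A I]
    (f : M →ₗ[A] I) (hf : Function.Injective f) :
    ∃ (E : Submodule A I) (g : M →ₗ[A] E), IsInjectiveEnvelope g := by
  let T : Set (Submodule A I) := {U | Module.Injective A U ∧ LinearMap.range f ≤ U}
  have hT : T.Nonempty := ⟨⊤, Module.Injective.of_isCompl (isCompl_top_bot), le_top⟩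
  obtain ⟨U, ⟨hU, hUf⟩, hmin⟩ := wellFounded_lt.has_min T hT
  let p : M →ₗ[A] U := f.codRestrict U (fun x => hUf ⟨x, rfl⟩)
  have hp : Function.Injective p := fun x y h => hf (congrArg Subtype.val h)
  refine ⟨U, p, hU, hp, fun W hW => ?_⟩
  have hpW : Function.Injective (W.mkQ ∘ₗ p) := by
    rw [← LinearMap.ker_eq_bot, eq_bot_iff]
    intro x hx
    have hx' : p x ∈ W := by simpa using hx
    have : p x ∈ W ⊓ LinearMap.range p := ⟨hx', x, rfl⟩
    rw [hW] at this
    exact hp (by simpa using this)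
  obtain ⟨g, hg⟩ := hU.out (W.mkQ ∘ₗ p) hpW p
  let φ : U →ₗ[A] U := g ∘ₗ W.mkQ
  have hφ : φ ∘ₗ p = p := LinearMap.ext hg
  have hφn : ∀ n, (φ ^ n) ∘ₗ p = p := by
    intro n
    induction n with
    | zero => rfl
    | succ n ih => rw [pow_succ, Module.End.mul_eq_comp, LinearMap.comp_assoc, hφ, ih]
  obtain ⟨n, hn, hn1⟩ := (φ.eventually_isCompl_ker_pow_range_pow.and
    (Filter.eventually_ge_atTop 1)).exists
  have hle : W ≤ LinearMap.ker (φ ^ n) := by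
    obtain ⟨m, rfl⟩ : ∃ m, n = m + 1 := ⟨n - 1, by omega⟩
    intro x hx
    have : φ x = 0 := by
      have : W.mkQ x = 0 := by simpa using hx
      simp only [φ, LinearMap.comp_apply, this, map_zero]
    rw [LinearMap.mem_ker, pow_succ, Module.End.mul_apply, this, map_zero]
  have hinj : Module.Injective A (LinearMap.range (φ ^ n)) := Module.Injective.of_isCompl hn.symm
  have hmem : Submodule.map U.subtype (LinearMap.range (φ ^ n)) ∈ T := by
    refine ⟨?_, ?_⟩
    · have e := Submodule.equivMapOfInjective U.subtype U.injective_subtype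
        (LinearMap.range (φ ^ n))
      refine ⟨fun X Y _ _ _ _ i hi j => ?_⟩
      obtain ⟨h, hh⟩ := hinj.out i hi (e.symm.toLinearMap ∘ₗ j)
      exact ⟨e.toLinearMap ∘ₗ h, fun x => by simp [hh]⟩
    · rintro _ ⟨x, rfl⟩
      refine ⟨p x, ⟨p x, ?_⟩, rfl⟩
      exact LinearMap.congr_fun (hφn n) x
  have hnot := hmin _ hmem
  have hleU : Submodule.map U.subtype (LinearMap.range (φ ^ n)) ≤ U := Submodule.map_subtype_le _ _
  have heq := (hleU.lt_or_eq).resolve_left hnot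
  have htop : LinearMap.range (φ ^ n) = ⊤ := by
    rw [eq_top_iff, ← Submodule.map_le_map_iff_of_injective U.injective_subtype, heq]
    simp
  have hk : LinearMap.ker (φ ^ n) = ⊥ := by
    have := hn.disjoint
    rwa [htop, disjoint_top] at this
  rw [eq_bot_iff]
  exact hle.trans hk.le

/-- The vector space `Hom_k(A, M)`, to be regarded as a left `A`-module through right multiplication
on `A`. -/
def Coind (k A M : Type u) [Field k] [Ring A] [Algebra k A] [AddCommGroup M] [Module k M] :
    Type u := A →ₗ[k] M

section Coind

variable {k : Type u} [Field k] [Algebra k A] {M : Type u} [AddCommGroup M] [Module k M]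

/-- The underlying linear map of an element of `Coind k A M`. -/
def Coind.toLin (f : Coind k A M) : A →ₗ[k] M := f

noncomputable instance : AddCommGroup (Coind k A M) := inferInstanceAs (AddCommGroup (A →ₗ[k] M))
noncomputable instance : Module k (Coind k A M) := inferInstanceAs (Module k (A →ₗ[k] M))

noncomputable instance : Module A (Coind k A M) where
  smul a f := LinearMap.comp f.toLin (LinearMap.mulRight k a)
  one_smul f := LinearMap.ext fun x => congrArg f.toLin (mul_one x)
  mul_smul a b f := LinearMap.ext fun x => congrArg f.toLin (mul_assoc x a b).symm
  smul_zero _ := rfl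
  smul_add _ _ _ := rfl
  add_smul a b f := LinearMap.ext fun x =>
    (congrArg f.toLin (mul_add x a b)).trans (LinearMap.map_add f.toLin _ _)
  zero_smul f := LinearMap.ext fun x =>
    (congrArg f.toLin (mul_zero x)).trans (LinearMap.map_zero f.toLin)

instance : IsScalarTower k A (Coind k A M) :=
  ⟨fun c a f => LinearMap.ext fun x =>
    (congrArg f.toLin (mul_smul_comm c x a)).trans (LinearMap.map_smul f.toLin c _)⟩

instance [Module.Finite k A] [Module.Finite k M] : Module.Finite k (Coind k A M) :=
  inferInstanceAs (Module.Finite k (A →ₗ[k] M))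

instance : Module.Injective A (Coind k A M) where
  out X Y _ _ _ _ f hf g := by
    let _ := Module.restrictScalars k A X
    let _ := Module.restrictScalars k A Y
    have := IsScalarTower.restrictScalars k A X
    have := IsScalarTower.restrictScalars k A Y
    let ev : X →ₗ[k] M :=
      { toFun := fun x => (g x).toLin 1
        map_add' := fun x y => by rw [map_add]; rfl
        map_smul' := fun c x => by
          rw [LinearMap.map_smul_of_tower g]; rfl }
    obtain ⟨q, hq⟩ := LinearMap.exists_leftInverse_of_injective (f.restrictScalars k)
      (LinearMap.ker_eq_bot.2 hf)
    let e : Y →ₗ[k] M := ev ∘ₗ q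
    have he : ∀ x, e (f x) = (g x).toLin 1 := fun x =>
      congrArg ev (LinearMap.congr_fun hq x)
    refine ⟨
      { toFun := fun y => (e ∘ₗ (LinearMap.toSpanSingleton A Y y).restrictScalars k :)
        map_add' := fun y z => LinearMap.ext fun a => by
          change e (a • (y + z)) = e (a • y) + e (a • z)
          rw [smul_add, map_add]
        map_smul' := fun b y => LinearMap.ext fun a => by
          change e (a • b • y) = e ((a * b) • y)
          rw [mul_smul] }, fun x => LinearMap.ext fun a => ?_⟩
    change e (a • f x) = _
    rw [← map_smul, he, map_smul]
    exact congrArg (g x).toLin (one_mul a)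

end Coind

theorem exists_isInjectiveEnvelope (k : Type u) [Field k] [Algebra k A] [Module.Finite k A]
    (M : FGModuleCat.{u} A) :
    ∃ (I : FGModuleCat.{u} A) (f : M →ₗ[A] I), IsInjectiveEnvelope f := by
  let _ := Module.restrictScalars k A M
  have := IsScalarTower.restrictScalars k A M
  have : Module.Finite k M := Module.Finite.trans A M
  have : Module.Finite A (Coind k A M) := Module.Finite.of_restrictScalars_finite k A _
  have : IsArtinianRing A := IsArtinianRing.of_finite k A
  let i : M →ₗ[A] Coind k A M :=
    { toFun := fun m => (LinearMap.toSpanSingleton A M m).restrictScalars k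
      map_add' := fun m n => LinearMap.ext fun a => smul_add a m n
      map_smul' := fun b m => LinearMap.ext fun a => (mul_smul a b m).symm }
  have hi : Function.Injective i := fun m n h => by
    have := LinearMap.congr_fun (show (LinearMap.toSpanSingleton A M m).restrictScalars k =
      (LinearMap.toSpanSingleton A M n).restrictScalars k from h) 1
    simpa using this
  obtain ⟨E, g, hg⟩ := Submodule.exists_isInjectiveEnvelope i hi
  exact ⟨FGModuleCat.of A E, g, hg⟩

end Covers

namespace D4

variable {k : Type u} [Field k]

instance : IsArtinianRing (D4 k) := IsArtinianRing.of_finite k (D4 k)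

/-- The projective cover `P(M)` of a finite dimensional `D4`-module `M`. -/
noncomputable def projCover (M : FGModuleCat.{u} (D4 k)) : FGModuleCat.{u} (D4 k) :=
  (exists_isProjectiveCover M).choose

/-- The covering map `P(M) → M`. -/
noncomputable def projCoverMap (M : FGModuleCat.{u} (D4 k)) : projCover M →ₗ[D4 k] M :=
  (exists_isProjectiveCover M).choose_spec.choose

theorem isProjectiveCover_projCoverMap (M : FGModuleCat.{u} (D4 k)) :
    IsProjectiveCover (projCoverMap M) :=
  (exists_isProjectiveCover M).choose_spec.choose_spec

/-- The injective envelope `I(M)` of a finite dimensional `D4`-module `M`. -/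
noncomputable def injEnvelope (M : FGModuleCat.{u} (D4 k)) : FGModuleCat.{u} (D4 k) :=
  (exists_isInjectiveEnvelope k M).choose

/-- The embedding `M → I(M)`. -/
noncomputable def injEnvelopeMap (M : FGModuleCat.{u} (D4 k)) : M →ₗ[D4 k] injEnvelope M :=
  (exists_isInjectiveEnvelope k M).choose_spec.choose

theorem isInjectiveEnvelope_injEnvelopeMap (M : FGModuleCat.{u} (D4 k)) :
    IsInjectiveEnvelope (injEnvelopeMap M) :=
  (exists_isInjectiveEnvelope k M).choose_spec.choose_spec

/-- The syzygy `Ω M`, the kernel of the projective cover `P(M) → M`. -/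
noncomputable def syzygy (M : FGModuleCat.{u} (D4 k)) : FGModuleCat.{u} (D4 k) :=
  FGModuleCat.of (D4 k) (LinearMap.ker (projCoverMap M))

/-- The cosyzygy `Ω⁻¹ M`, the cokernel of the injective envelope `M → I(M)`. -/
noncomputable def cosyzygy (M : FGModuleCat.{u} (D4 k)) : FGModuleCat.{u} (D4 k) :=
  FGModuleCat.of (D4 k) (injEnvelope M ⧸ LinearMap.range (injEnvelopeMap M))

/-- The modules `Ω^n M` for an integer `n`: iterated syzygies if `n > 0`, the module `M` itself if
`n = 0`, iterated cosyzygies if `n < 0`. -/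
noncomputable def Omega : ℤ → FGModuleCat.{u} (D4 k) → FGModuleCat.{u} (D4 k)
  | .ofNat n, M => syzygy^[n] M
  | .negSucc n, M => cosyzygy^[n + 1] M

variable (k)

/-- The projective cover `P(r)` of the simple module `V(r)`. -/
noncomputable def P (r : ZMod 2) : FGModuleCat.{u} (D4 k) := projCover (V k r)

end D4

/-! Where `bc` acts as the identity, `b` and `c` act by the same involution and the relations become
those of the exterior algebra on `a` and `d`, graded by parity. The modules `Fr` are free over this
exterior algebra. They are projective and also injective: since 2 is invertible, linear lifts and
extensions can be made compatible with parity by the idempotents `proj`.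

The modules Ω^s V and Ω^{-t} V have radical square zero, so each is a pair of linear maps `A`, `D`
from a space U to a space W (`Kr`). Write F_n for the polynomials of degree less than n. The
cosyzygies are multiplication by X and by 1 from F_t to F_{t+1} (`NegKr`), and the syzygies are the
transposes (`PosKr`). One more step of Ω^{-1} or Ω is the exact sequence 0 → F_n → F_{n+1}² →
F_{n+2} → 0 or its dual (`cosyzygy_negKr`, `syzygy_posKr`).

In the tensor product of `PosKr` and `NegKr`, the element `ad` maps U ⊗ U' to W ⊗ W' by `wedge`, up
to sign. If U ⊗ U' is read as the operators from F_{s+1} to F_t, a tensor killed by `wedge` is an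
operator that commutes with X, hence multiplication by a polynomial of degree less than t - s
(`val_dualTensorHom_X_pow`, `finrank_ker_formsWedge_le`). So `wedge` is injective for t ≤ s and
surjective for s ≤ t.

For t ≤ s, the space U ⊗ U' generates a free submodule, which splits off because it is injective;
contraction of functionals with forms maps the tensor product onto the model of Ω^{s-t} V and kills
U ⊗ U' (`posKr_tensor_negKr_of_le`). For s ≤ t, preimages of W ⊗ W' under `wedge` generate a free
submodule, and multiplication operators embed the model of Ω^{s-t} V independently of it
(`posKr_tensor_negKr_of_ge`). A dimension count finishes both cases. The parity of the free part is
the sum of the parities r + s of U and r' + t + 1 of U', which is why the index of the projective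
summand depends on s + t. -/

/-! ### Uniqueness of projective covers and injective envelopes -/

section Covers

variable {A : Type u} [Ring A]

/-- Projective covers of isomorphic modules are isomorphic over the given isomorphism. -/
theorem IsProjectiveCover.exists_equiv {P P' M M' : Type u} [AddCommGroup P] [Module A P]
    [AddCommGroup P'] [Module A P'] [AddCommGroup M] [Module A M] [AddCommGroup M'] [Module A M']
    {f : P →ₗ[A] M} {f' : P' →ₗ[A] M'} (hf : IsProjectiveCover f) (hf' : IsProjectiveCover f')
    (e : M ≃ₗ[A] M') : ∃ E : P ≃ₗ[A] P', ∀ x, f' (E x) = e (f x) := by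
  have := hf.projective
  have := hf'.projective
  obtain ⟨g, hg⟩ := Module.projective_lifting_property f' (e.toLinearMap ∘ₗ f) hf'.surjective
  replace hg : ∀ x, f' (g x) = e (f x) := LinearMap.congr_fun hg
  have hgs : Function.Surjective g := by
    rw [← LinearMap.range_eq_top]
    refine hf'.superfluous _ (eq_top_iff.2 fun y _ => ?_)
    obtain ⟨x, hx⟩ := hf.surjective (e.symm (f' y))
    refine Submodule.mem_sup.2 ⟨g x, ⟨x, rfl⟩, y - g x, ?_, by abel⟩
    simp [hg, hx]
  obtain ⟨h, hh⟩ := Module.projective_lifting_property g LinearMap.id hgs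
  replace hh : ∀ x, g (h x) = x := LinearMap.congr_fun hh
  -- The section `h` lifts the inverse of `e`, so superfluity of the kernel of `f` makes it onto as
  -- well; this forces `g` to be injective.
  have hhs : Function.Surjective h := by
    rw [← LinearMap.range_eq_top]
    refine hf.superfluous _ (eq_top_iff.2 fun x _ => ?_)
    refine Submodule.mem_sup.2 ⟨h (g x), ⟨g x, rfl⟩, x - h (g x), ?_, by abel⟩
    apply e.injective
    rw [map_sub, map_sub, ← hg, ← hg, hh, sub_self, map_zero]
  have hgi : Function.Injective g := by
    intro x y hxy
    obtain ⟨x, rfl⟩ := hhs x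
    obtain ⟨y, rfl⟩ := hhs y
    rw [hh, hh] at hxy
    rw [hxy]
  exact ⟨LinearEquiv.ofBijective g ⟨hgi, hgs⟩, hg⟩

/-- Injective envelopes of isomorphic modules are isomorphic under the given isomorphism. -/
theorem IsInjectiveEnvelope.exists_equiv {I I' M M' : Type u} [AddCommGroup I] [Module A I]
    [AddCommGroup I'] [Module A I'] [AddCommGroup M] [Module A M] [AddCommGroup M'] [Module A M']
    {f : M →ₗ[A] I} {f' : M' →ₗ[A] I'} (hf : IsInjectiveEnvelope f) (hf' : IsInjectiveEnvelope f')
    (e : M ≃ₗ[A] M') : ∃ E : I ≃ₗ[A] I', ∀ x, E (f x) = f' (e x) := by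
  obtain ⟨g, hg⟩ := hf'.injective_module.out f hf.injective (f' ∘ₗ e.toLinearMap)
  replace hg : ∀ x, g (f x) = f' (e x) := hg
  have hgi : Function.Injective g := by
    rw [← LinearMap.ker_eq_bot]
    refine hf.essential _ (eq_bot_iff.2 ?_)
    rintro _ ⟨hx, ⟨x, rfl⟩⟩
    have h0 : f' (e x) = f' (e 0) := by rw [← hg, LinearMap.mem_ker.1 hx, map_zero, map_zero]
    simp [e.injective (hf'.injective h0)]
  obtain ⟨h, hh⟩ := hf.injective_module.out g hgi LinearMap.id
  replace hh : ∀ x, h (g x) = x := hh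
  -- Dually, the retraction `h` extends the inverse of `e`, so essentiality of the range of `f'`
  -- makes it injective, and then `g` is onto.
  have hhi : Function.Injective h := by
    rw [← LinearMap.ker_eq_bot]
    refine hf'.essential _ (eq_bot_iff.2 ?_)
    rintro _ ⟨hx, ⟨x, rfl⟩⟩
    obtain ⟨x, rfl⟩ := e.surjective x
    have h0 : f x = 0 := by rw [← hh (f x), hg]; exact hx
    rw [← hg, h0, map_zero]; exact Submodule.zero_mem _
  have hgs : Function.Surjective g := fun y => ⟨h y, hhi (hh (h y))⟩
  exact ⟨LinearEquiv.ofBijective g ⟨hgi, hgs⟩, hg⟩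

end Covers

/-! ### Syzygies and cosyzygies from arbitrary covers and envelopes -/

namespace D4

variable {k : Type u} [Field k]

/-- Uniqueness of the cover frees the syzygy from the chosen one: any explicit cover of any
isomorphic module computes it. The next lemma is the dual. -/
theorem syzygy_equiv {M : FGModuleCat.{u} (D4 k)} {N P K : Type u} [AddCommGroup N]
    [Module (D4 k) N] [AddCommGroup P] [Module (D4 k) P] [AddCommGroup K] [Module (D4 k) K]
    (e : M ≃ₗ[D4 k] N) {f : P →ₗ[D4 k] N} (hf : IsProjectiveCover f) (i : K →ₗ[D4 k] P)
    (hi : Function.Injective i) (hr : LinearMap.range i = LinearMap.ker f) :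
    Nonempty (syzygy M ≃ₗ[D4 k] K) := by
  obtain ⟨E, hE⟩ := (isProjectiveCover_projCoverMap M).exists_equiv hf e
  have h : Submodule.map E.toLinearMap (LinearMap.ker (projCoverMap M)) = LinearMap.range i := by
    rw [hr]
    ext y
    constructor
    · rintro ⟨x, hx, rfl⟩
      have hx' : projCoverMap M x = 0 := hx
      simp [hE, hx']
    · intro hy
      refine ⟨E.symm y, ?_, by simp⟩
      have : e (projCoverMap M (E.symm y)) = 0 := by rw [← hE]; simpa using hy
      simpa using this
  exact ⟨(E.ofSubmodules _ _ h).trans (LinearEquiv.ofInjective i hi).symm⟩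

theorem cosyzygy_equiv {M : FGModuleCat.{u} (D4 k)} {N I C : Type u} [AddCommGroup N]
    [Module (D4 k) N] [AddCommGroup I] [Module (D4 k) I] [AddCommGroup C] [Module (D4 k) C]
    (e : M ≃ₗ[D4 k] N) {f : N →ₗ[D4 k] I} (hf : IsInjectiveEnvelope f) (q : I →ₗ[D4 k] C)
    (hq : Function.Surjective q) (hr : LinearMap.range f = LinearMap.ker q) :
    Nonempty (cosyzygy M ≃ₗ[D4 k] C) := by
  obtain ⟨E, hE⟩ := (isInjectiveEnvelope_injEnvelopeMap M).exists_equiv hf e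
  have h : Submodule.map E.toLinearMap (LinearMap.range (injEnvelopeMap M)) = LinearMap.ker q := by
    rw [← hr]
    ext y
    constructor
    · rintro ⟨_, ⟨x, rfl⟩, rfl⟩
      exact ⟨e x, (hE x).symm⟩
    · rintro ⟨x, rfl⟩
      exact ⟨_, ⟨e.symm x, rfl⟩, by simp [hE]⟩
  exact ⟨(Submodule.Quotient.equiv _ _ E h).trans (q.quotKerEquivOfSurjective hq)⟩

/-! ### Homomorphisms checked on generators, and modules given by representations -/

section Gen

variable {X Y : Type*} [AddCommGroup X] [Module k X] [Module (D4 k) X] [IsScalarTower k (D4 k) X]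
  [AddCommGroup Y] [Module k Y] [Module (D4 k) Y] [IsScalarTower k (D4 k) Y]

/-- A linear map that commutes with the generators is a homomorphism of `D4`-modules. -/
def homOfGen (f : X →ₗ[k] Y) (h : ∀ g x, f (gen k g • x) = gen k g • f x) : X →ₗ[D4 k] Y where
  toFun := f
  map_add' := f.map_add
  map_smul' y x := by
    let S : Submodule k (D4 k) :=
      { carrier := {y | ∀ x, f (y • x) = y • f x}
        add_mem' := fun hy hz x => by rw [add_smul, map_add, hy, hz, add_smul]
        zero_mem' := fun x => by simp
        smul_mem' := fun c y hy x => by rw [smul_assoc, map_smul, hy, smul_assoc] }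
    have hS : S = ⊤ := eq_top_of_gen_mul_mem S (fun x => by simp) fun g y hy x => by
      rw [mul_smul, h, hy, mul_smul]
    exact (hS ▸ Submodule.mem_top : y ∈ S) x

@[simp] theorem homOfGen_apply (f : X →ₗ[k] Y) (h : ∀ g x, f (gen k g • x) = gen k g • f x)
    (x : X) : homOfGen f h x = f x := rfl

end Gen

/-- The space of a representation of `D4`, as a `D4`-module. -/
def RepMod {W : Type u} [AddCommGroup W] [Module k W] (_ρ : D4 k →ₐ[k] Module.End k W) : Type u := W

namespace RepMod

variable {W : Type u} [AddCommGroup W] [Module k W] (ρ : D4 k →ₐ[k] Module.End k W)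

instance : AddCommGroup (RepMod ρ) := inferInstanceAs (AddCommGroup W)
instance : Module k (RepMod ρ) := inferInstanceAs (Module k W)
instance [Module.Finite k W] : Module.Finite k (RepMod ρ) := inferInstanceAs (Module.Finite k W)
noncomputable instance : Module (D4 k) (RepMod ρ) := Module.compHom W ρ.toRingHom

/-- The identification of a representation space with the module. -/
def of : W ≃ₗ[k] RepMod ρ := LinearEquiv.refl k W

theorem smul_of (x : D4 k) (w : W) : x • of ρ w = of ρ (ρ x w) := rfl

instance : IsScalarTower k (D4 k) (RepMod ρ) := ⟨fun x y w => by
  obtain ⟨w, rfl⟩ := (of ρ).surjective w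
  rw [smul_of, smul_of, map_smul, LinearMap.smul_apply, map_smul]⟩

theorem finrank_eq : Module.finrank k (RepMod ρ) = Module.finrank k W :=
  (of ρ).symm.finrank_eq

variable {ρ} {W' : Type u} [AddCommGroup W'] [Module k W'] {ρ' : D4 k →ₐ[k] Module.End k W'}

/-- A linear map that intertwines the actions of the generators. -/
noncomputable def hom (f : W →ₗ[k] W') (h : ∀ g w, f (ρ (gen k g) w) = ρ' (gen k g) (f w)) :
    RepMod ρ →ₗ[D4 k] RepMod ρ' :=
  homOfGen ((of ρ').toLinearMap ∘ₗ f ∘ₗ (of ρ).symm.toLinearMap) fun g x => by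
    obtain ⟨w, rfl⟩ := (of ρ).surjective x
    simp [smul_of, h]

@[simp] theorem hom_of (f : W →ₗ[k] W') (h : ∀ g w, f (ρ (gen k g) w) = ρ' (gen k g) (f w))
    (w : W) : hom f h (of ρ w) = of ρ' (f w) := rfl

/-- A linear equivalence that intertwines the actions of the generators. -/
noncomputable def equiv (f : W ≃ₗ[k] W') (h : ∀ g w, f (ρ (gen k g) w) = ρ' (gen k g) (f w)) :
    RepMod ρ ≃ₗ[D4 k] RepMod ρ' :=
  LinearEquiv.ofBijective (hom f.toLinearMap h) f.bijective

theorem hom_injective {f : W →ₗ[k] W'} {h : ∀ g w, f (ρ (gen k g) w) = ρ' (gen k g) (f w)}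
    (hf : Function.Injective f) : Function.Injective (hom f h) := hf

theorem hom_surjective {f : W →ₗ[k] W'} {h : ∀ g w, f (ρ (gen k g) w) = ρ' (gen k g) (f w)}
    (hf : Function.Surjective f) : Function.Surjective (hom f h) := hf

/-- The object `ofRep ρ` has `RepMod ρ` as its underlying module. -/
noncomputable def ofRepEquiv [Module.Finite k W] : ofRep ρ ≃ₗ[D4 k] RepMod ρ :=
  letI : Module (D4 k) W := Module.compHom W ρ.toRingHom
  (LinearEquiv.refl (D4 k) W : W ≃ₗ[D4 k] W)

end RepMod

/-! ### The action on tensor products -/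

section Tensor

variable (k) (X Y : Type u) [AddCommGroup X] [Module k X] [Module (D4 k) X] [IsScalarTower k (D4 k) X]
  [AddCommGroup Y] [Module k Y] [Module (D4 k) Y] [IsScalarTower k (D4 k) Y]

/-- The representation of `D4` on a tensor product. -/
noncomputable def tensorRep : D4 k →ₐ[k] Module.End k (X ⊗[k] Y) :=
  (Module.endTensorEndAlgHom (R := k) (S := k) (A := k) (M := X) (N := Y)).comp
      ((Algebra.TensorProduct.map (Algebra.lsmul k k X) (Algebra.lsmul k k Y)).comp
        (Bialgebra.comulAlgHom k (D4 k)))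

theorem comul_gen (g : D4Gen) : Coalgebra.comul (R := k) (gen k g) = comulGen k g :=
  lift_gen _ (respects_comulGen k) g

theorem tensorRep_gen_a (x : X) (y : Y) : tensorRep k X Y (gen k .a) (x ⊗ₜ y) =
    (gen k .a • x) ⊗ₜ (gen k .b • y) + x ⊗ₜ (gen k .a • y) := by
  simp [tensorRep, comul_gen, comulGen, Module.endTensorEndAlgHom_apply]

theorem tensorRep_gen_b (x : X) (y : Y) : tensorRep k X Y (gen k .b) (x ⊗ₜ y) =
    (gen k .b • x) ⊗ₜ (gen k .b • y) := by
  simp [tensorRep, comul_gen, comulGen, Module.endTensorEndAlgHom_apply]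

theorem tensorRep_gen_c (x : X) (y : Y) : tensorRep k X Y (gen k .c) (x ⊗ₜ y) =
    (gen k .c • x) ⊗ₜ (gen k .c • y) := by
  simp [tensorRep, comul_gen, comulGen, Module.endTensorEndAlgHom_apply]

theorem tensorRep_gen_d (x : X) (y : Y) : tensorRep k X Y (gen k .d) (x ⊗ₜ y) =
    (gen k .d • x) ⊗ₜ (gen k .c • y) + x ⊗ₜ (gen k .d • y) := by
  simp [tensorRep, comul_gen, comulGen, Module.endTensorEndAlgHom_apply]

variable {k X Y} {X' Y' : Type u} [AddCommGroup X'] [Module k X'] [Module (D4 k) X']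
  [IsScalarTower k (D4 k) X'] [AddCommGroup Y'] [Module k Y'] [Module (D4 k) Y']
  [IsScalarTower k (D4 k) Y']

theorem tensorRep_congr (e : X ≃ₗ[D4 k] X') (e' : Y ≃ₗ[D4 k] Y') :
    Nonempty (RepMod (tensorRep k X Y) ≃ₗ[D4 k] RepMod (tensorRep k X' Y')) :=
  ⟨RepMod.equiv (TensorProduct.congr (e.restrictScalars k) (e'.restrictScalars k)) fun g z => by
    induction z with
    | zero => simp
    | add z w hz hw => simp only [map_add, hz, hw]
    | tmul x y => cases g <;>
      simp [tensorRep_gen_a, tensorRep_gen_b, tensorRep_gen_c, tensorRep_gen_d]⟩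

-- The iterated syzygies are known only up to isomorphism; this replaces both factors by explicit
-- models before any computation.
open scoped ModuleCat in
theorem tensor_congr {M N : FGModuleCat.{u} (D4 k)} (e : M ≃ₗ[D4 k] X) (e' : N ≃ₗ[D4 k] Y) :
    Nonempty (tensor M N ≃ₗ[D4 k] RepMod (tensorRep k X Y)) := by
  have := finite_over_field M
  have := finite_over_field N
  obtain ⟨E⟩ := tensorRep_congr e e'
  exact ⟨(RepMod.ofRepEquiv (ρ := tensorRep k M N)).trans E⟩

end Tensor

end D4

/-! ### Signs, socle and top in the block where `bc = 1`, and parity projections -/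

namespace D4

variable {k : Type u} [Field k]

section Sign

variable (k) in
/-- The scalar by which `b` and `c` act on `V(p)`. -/
def sgn (p : ZMod 2) : k := (-1) ^ p.val

@[simp] theorem sgn_mul_self (p : ZMod 2) : sgn k p * sgn k p = 1 := by
  rw [sgn, ← mul_pow]; simp

@[simp] theorem sgn_smul_sgn_smul {X : Type*} [AddCommGroup X] [Module k X] (p : ZMod 2) (x : X) :
    sgn k p • sgn k p • x = x := by
  rw [smul_smul, sgn_mul_self, one_smul]

theorem sgn_add (p q : ZMod 2) : sgn k (p + q) = sgn k p * sgn k q := by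
  have h : ∀ p : ZMod 2, p = 0 ∨ p = 1 := by decide
  have h11 : (1 + 1 : ZMod 2) = 0 := rfl
  have h1 : (1 : ZMod 2).val = 1 := rfl
  rcases h p with rfl | rfl <;> rcases h q with rfl | rfl <;> simp [sgn, h11, h1]

@[simp] theorem sgn_one : sgn k 1 = -1 := by
  have h1 : (1 : ZMod 2).val = 1 := rfl
  simp [sgn, h1]

@[simp] theorem sgn_add_one (p : ZMod 2) : sgn k (p + 1) = -sgn k p := by
  simp [sgn_add]

end Sign

section Module

variable {X : Type*} [AddCommGroup X] [Module (D4 k) X]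

theorem ba_smul (x : X) : gen k .b • gen k .a • x = -(gen k .a • gen k .b • x) := by
  simp only [← mul_smul, rel_ba, neg_smul]
theorem db_smul (x : X) : gen k .d • gen k .b • x = -(gen k .b • gen k .d • x) := by
  simp only [← mul_smul, rel_db, neg_smul]
theorem ca_smul (x : X) : gen k .c • gen k .a • x = -(gen k .a • gen k .c • x) := by
  simp only [← mul_smul, rel_ca, neg_smul]
theorem dc_smul (x : X) : gen k .d • gen k .c • x = -(gen k .c • gen k .d • x) := by
  simp only [← mul_smul, rel_dc, neg_smul]
@[simp] theorem aa_smul (x : X) : gen k .a • gen k .a • x = 0 := by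
  rw [← mul_smul, rel_aa, zero_smul]
@[simp] theorem dd_smul (x : X) : gen k .d • gen k .d • x = 0 := by
  rw [← mul_smul, rel_dd, zero_smul]
theorem da_smul (x : X) : gen k .d • gen k .a • x =
    x - gen k .b • gen k .c • x - gen k .a • gen k .d • x := by
  have h := congrArg (· • x) (rel_da k)
  simp only [add_smul, sub_smul, mul_smul, one_smul] at h
  rw [← h]; abel

/-- In the block of the trivial module, a submodule without vectors killed by `a` and `d`
vanishes. -/
theorem eq_bot_of_socle (hbc : ∀ x : X, gen k .b • gen k .c • x = x) (U : Submodule (D4 k) X)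
    (h : ∀ x ∈ U, gen k .a • x = 0 → gen k .d • x = 0 → x = 0) : U = ⊥ := by
  have hda : ∀ x : X, gen k .d • gen k .a • x = -(gen k .a • gen k .d • x) := fun x => by
    rw [da_smul, hbc]; simp
  rw [Submodule.eq_bot_iff]
  -- Since `da = -ad` and `a`, `d` square to zero, the vectors `adx`, then `ax` and `dx`, then `x`
  -- are in turn killed by both `a` and `d`, so each vanishes.
  have had : ∀ x ∈ U, gen k .a • gen k .d • x = 0 := fun x hx =>
    h _ (U.smul_mem _ (U.smul_mem _ hx)) (by simp) (by rw [hda]; simp)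
  have ha : ∀ x ∈ U, gen k .a • x = 0 := fun x hx =>
    h _ (U.smul_mem _ hx) (by simp) (by rw [hda, had x hx, neg_zero])
  have hd : ∀ x ∈ U, gen k .d • x = 0 := fun x hx =>
    h _ (U.smul_mem _ hx) (had x hx) (by simp)
  exact fun x hx => h x hx (ha x hx) (hd x hx)

/-- The embeddings of free modules and of direct sums below are tested on vectors killed by `a` and
`d`, which in coordinates have hardly any nonzero entries. -/
theorem injective_of_socle {Y : Type*} [AddCommGroup Y] [Module (D4 k) Y]
    (hbc : ∀ x : X, gen k .b • gen k .c • x = x) (f : X →ₗ[D4 k] Y)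
    (h : ∀ x, f x = 0 → gen k .a • x = 0 → gen k .d • x = 0 → x = 0) : Function.Injective f := by
  rw [← LinearMap.ker_eq_bot]
  exact eq_bot_of_socle hbc _ h

/-- In the block of the trivial module, a submodule that spans the module modulo the images of `a`
and `d` is the whole module. -/
theorem eq_top_of_top (hbc : ∀ x : X, gen k .b • gen k .c • x = x) (U : Submodule (D4 k) X)
    (h : ∀ x, ∃ u ∈ U, ∃ y z, x = u + gen k .a • y + gen k .d • z) : U = ⊤ := by
  have hda : ∀ x : X, gen k .d • gen k .a • x = -(gen k .a • gen k .d • x) := fun x => by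
    rw [da_smul, hbc]; simp
  -- Nakayama's argument by hand: products of three factors `a` or `d` vanish. Applying `ad` to a
  -- decomposition of `x` leaves only the term from `u`; then one substitution for `y` and one for
  -- `z` suffice.
  have had : ∀ x : X, gen k .a • gen k .d • x ∈ U := fun x => by
    obtain ⟨u, hu, y, z, rfl⟩ := h x
    simpa [hda] using U.smul_mem _ (U.smul_mem _ hu)
  rw [eq_top_iff]
  intro x _
  obtain ⟨u, hu, y, z, rfl⟩ := h x
  refine U.add_mem (U.add_mem hu ?_) ?_
  · obtain ⟨u, hu, y, z, rfl⟩ := h y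
    simpa using U.add_mem (U.smul_mem _ hu) (had z)
  · obtain ⟨u, hu, y, z, rfl⟩ := h z
    simpa [hda, ← sub_eq_add_neg] using U.sub_mem (U.smul_mem _ hu) (had y)

variable (k) in
/-- The projection to the part on which `b` and `c` act by `sgn k p`. -/
noncomputable def proj (p : ZMod 2) : D4 k :=
  (4⁻¹ : k) • ((1 + sgn k p • gen k .b) * (1 + sgn k p • gen k .c))

theorem b_mul_proj (p : ZMod 2) : gen k .b * proj k p = sgn k p • proj k p := by
  simp only [proj, mul_smul_comm, ← mul_assoc, mul_add, smul_add, smul_smul, smul_mul_assoc,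
    rel_bb, mul_one, add_mul, one_mul, ← mul_assoc, sgn_mul_self, mul_comm (sgn k p)]
  simp only [mul_assoc, sgn_mul_self, mul_one, ← smul_smul]
  abel

theorem c_mul_proj (p : ZMod 2) : gen k .c * proj k p = sgn k p • proj k p := by
  have : proj k p = (4⁻¹ : k) • ((1 + sgn k p • gen k .c) * (1 + sgn k p • gen k .b)) := by
    simp only [proj, mul_add, add_mul, mul_smul_comm, smul_mul_assoc, rel_bc, mul_one, one_mul,
      smul_add]
    abel
  rw [this]
  simp only [mul_smul_comm, ← mul_assoc, mul_add, smul_add, smul_smul, smul_mul_assoc,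
    rel_cc, mul_one, add_mul, one_mul, ← mul_assoc, sgn_mul_self, mul_comm (sgn k p)]
  simp only [mul_assoc, sgn_mul_self, mul_one, ← smul_smul]
  abel

theorem proj_mul_b (p : ZMod 2) : proj k p * gen k .b = sgn k p • proj k p := by
  have h : Commute (gen k .b) (gen k .c) := rel_bc k
  rw [← b_mul_proj]
  exact ((((Commute.one_left _).add_left ((Commute.refl _).smul_left _)).mul_left
    ((Commute.one_left _).add_left (h.symm.smul_left _))).smul_left _).eq

theorem proj_mul_c (p : ZMod 2) : proj k p * gen k .c = sgn k p • proj k p := by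
  have h : Commute (gen k .b) (gen k .c) := rel_bc k
  rw [← c_mul_proj]
  exact ((((Commute.one_left _).add_left (h.smul_left _)).mul_left
    ((Commute.one_left _).add_left ((Commute.refl _).smul_left _))).smul_left _).eq

variable [Module k X] [IsScalarTower k (D4 k) X]

theorem b_smul_proj_smul (p : ZMod 2) (x : X) :
    gen k .b • proj k p • x = sgn k p • proj k p • x := by
  rw [← mul_smul, b_mul_proj, smul_assoc]

theorem c_smul_proj_smul (p : ZMod 2) (x : X) :
    gen k .c • proj k p • x = sgn k p • proj k p • x := by
  rw [← mul_smul, c_mul_proj, smul_assoc]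

theorem proj_smul_b_smul (p : ZMod 2) (x : X) :
    proj k p • gen k .b • x = sgn k p • proj k p • x := by
  rw [← mul_smul, proj_mul_b, smul_assoc]

theorem proj_smul_c_smul (p : ZMod 2) (x : X) :
    proj k p • gen k .c • x = sgn k p • proj k p • x := by
  rw [← mul_smul, proj_mul_c, smul_assoc]

/-- On such a vector each of the two factors of `proj` acts by 2, which the factor 1/4 cancels; this
needs 2 to be invertible. -/
theorem proj_smul (h2 : (2 : k) ≠ 0) (p : ZMod 2) {x : X} (hb : gen k .b • x = sgn k p • x)
    (hc : gen k .c • x = sgn k p • x) : proj k p • x = x := by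
  have h4 : (4⁻¹ : k) * (2 * 2) = 1 := by
    rw [show (2 * 2 : k) = 4 by norm_num]
    exact inv_mul_cancel₀ (by rw [show (4 : k) = 2 * 2 by norm_num]; exact mul_ne_zero h2 h2)
  have hs : ∀ g, gen k g • x = sgn k p • x → (1 + sgn k p • gen k g) • x = (2 : k) • x := by
    intro g hg
    rw [add_smul, one_smul, smul_assoc, hg, sgn_smul_sgn_smul, two_smul]
  rw [proj, smul_assoc, mul_smul, hs .c hc, smul_algebra_smul_comm, hs .b hb, smul_smul, smul_smul,
    mul_assoc, h4, one_smul]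

end Module

/-- The algebra homomorphism that sends `b` and `c` to `S`, `a` to `A` and `d` to `D`. -/
noncomputable def gradedRep {W : Type u} [AddCommGroup W] [Module k W] (S A D : Module.End k W)
    (hS : S * S = 1) (hSA : S * A = -(A * S)) (hDS : D * S = -(S * D)) (hA : A * A = 0)
    (hD : D * D = 0) (hDA : D * A + A * D = 0) : D4 k →ₐ[k] Module.End k W :=
  lift (fun | .a => A | .b => S | .c => S | .d => D)
    ⟨hSA, hDS, hSA, hDS, rfl, hA, hS, hS, hD, by simp [hS, hDA]⟩

end D4

/-! ### Free modules over the exterior algebra: projectivity, injectivity, covers and envelopes -/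

namespace D4

variable {k : Type u} [Field k]

section Free

variable (k) (p : ZMod 2) (U : Type u) [AddCommGroup U] [Module k U]

/-- The representation of `D4` on `U ⊗ Λ(a, d)`, where `b` and `c` act on `U` by `sgn k p`. -/
noncomputable def freeRep : D4 k →ₐ[k] Module.End k (U × U × U × U) :=
  gradedRep
    { toFun := fun m => (sgn k p • m.1, -(sgn k p • m.2.1), -(sgn k p • m.2.2.1),
        sgn k p • m.2.2.2)
      map_add' := fun m n => by simp [add_comm]
      map_smul' := fun c m => by simp [smul_comm c] }
    { toFun := fun m => (0, m.1, 0, m.2.2.1)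
      map_add' := fun m n => by simp
      map_smul' := fun c m => by simp }
    -- The coordinates refer to `1`, `a`, `d`, `ad` in this order; the sign is that of `da = -ad`.
    { toFun := fun m => (0, 0, m.1, -m.2.1)
      map_add' := fun m n => by simp [add_comm]
      map_smul' := fun c m => by simp }
    (LinearMap.ext fun m => by simp)
    (LinearMap.ext fun m => by simp)
    (LinearMap.ext fun m => by simp)
    (LinearMap.ext fun m => by simp)
    (LinearMap.ext fun m => by simp)
    (LinearMap.ext fun m => by simp)

/-- The module `U ⊗ Λ(a, d)`, where `b` and `c` act on `U` by `sgn k p`. Its elements have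
components along `1`, `a`, `d` and `ad`. -/
abbrev Fr : Type u := RepMod (freeRep k p U)

variable {k p U}

theorem freeRep_a (m : U × U × U × U) : freeRep k p U (gen k .a) m = (0, m.1, 0, m.2.2.1) := by
  simp [freeRep, gradedRep]
theorem freeRep_d (m : U × U × U × U) : freeRep k p U (gen k .d) m = (0, 0, m.1, -m.2.1) := by
  simp [freeRep, gradedRep]
theorem freeRep_b (m : U × U × U × U) : freeRep k p U (gen k .b) m =
    (sgn k p • m.1, -(sgn k p • m.2.1), -(sgn k p • m.2.2.1), sgn k p • m.2.2.2) := by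
  simp [freeRep, gradedRep]
theorem freeRep_c (m : U × U × U × U) : freeRep k p U (gen k .c) m =
    (sgn k p • m.1, -(sgn k p • m.2.1), -(sgn k p • m.2.2.1), sgn k p • m.2.2.2) := by
  simp [freeRep, gradedRep]

namespace Fr

theorem bc_smul_eq (x : Fr k p U) : gen k .b • gen k .c • x = x := by
  obtain ⟨m, rfl⟩ := (RepMod.of _).surjective x
  simp [RepMod.smul_of, freeRep_b, freeRep_c]

theorem hom_ext {X : Type*} [AddCommGroup X] [Module (D4 k) X] {f g : Fr k p U →ₗ[D4 k] X}
    (h : ∀ u, f (RepMod.of _ (u, 0, 0, 0)) = g (RepMod.of _ (u, 0, 0, 0))) : f = g := by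
  ext x
  obtain ⟨⟨u, v, w, z⟩, rfl⟩ := (RepMod.of _).surjective x
  have : RepMod.of (freeRep k p U) (u, v, w, z) = RepMod.of _ (u, 0, 0, 0) +
      gen k .a • RepMod.of _ (v, 0, 0, 0) + gen k .d • RepMod.of _ (w, 0, 0, 0) +
        gen k .a • gen k .d • RepMod.of _ (z, 0, 0, 0) := by
    simp [RepMod.smul_of, freeRep_a, freeRep_d, ← map_add]
  simp only [this, map_add, map_smul, h]

variable {X : Type*} [AddCommGroup X] [Module k X] [Module (D4 k) X] [IsScalarTower k (D4 k) X]

/-- The homomorphism out of `Fr k p U` with a given restriction to `U`. -/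
noncomputable def lift (φ : U →ₗ[k] X) (hb : ∀ u, gen k .b • φ u = sgn k p • φ u)
    (hc : ∀ u, gen k .c • φ u = sgn k p • φ u) : Fr k p U →ₗ[D4 k] X :=
  homOfGen
    ({ toFun := fun m => φ m.1 + gen k .a • φ m.2.1 + gen k .d • φ m.2.2.1 +
        gen k .a • gen k .d • φ m.2.2.2
       map_add' := fun m n => by simp only [Prod.fst_add, Prod.snd_add, map_add, smul_add]; abel
       map_smul' := fun c m => by
        simp only [Prod.smul_fst, Prod.smul_snd, map_smul, smul_add, smul_algebra_smul_comm,
          RingHom.id_apply] } ∘ₗ (RepMod.of (freeRep k p U)).symm.toLinearMap) (by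
    intro g x
    obtain ⟨⟨u, v, w, z⟩, rfl⟩ := (RepMod.of _).surjective x
    have hda : ∀ u, gen k .d • gen k .a • φ u = -(gen k .a • gen k .d • φ u) := fun u => by
      rw [da_smul, hc, smul_algebra_smul_comm, hb]; simp
    have hbd : ∀ x : X, gen k .b • gen k .d • x = -(gen k .d • gen k .b • x) := fun x => by
      rw [db_smul, neg_neg]
    have hcd : ∀ x : X, gen k .c • gen k .d • x = -(gen k .d • gen k .c • x) := fun x => by
      rw [dc_smul, neg_neg]
    have hdad : ∀ u, gen k .d • gen k .a • gen k .d • φ u = 0 := fun u => by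
      rw [← neg_eq_iff_eq_neg.2 (hda u), smul_neg, dd_smul, neg_zero]
    cases g <;>
      simp [RepMod.smul_of, freeRep_a, freeRep_b, freeRep_c, freeRep_d, hda, hdad, hb, hc,
        ba_smul, ca_smul, hbd, hcd, smul_algebra_smul_comm, add_comm])

theorem lift_of (φ : U →ₗ[k] X) (hb : ∀ u, gen k .b • φ u = sgn k p • φ u)
    (hc : ∀ u, gen k .c • φ u = sgn k p • φ u) (m : U × U × U × U) :
    lift φ hb hc (RepMod.of _ m) = φ m.1 + gen k .a • φ m.2.1 + gen k .d • φ m.2.2.1 +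
        gen k .a • gen k .d • φ m.2.2.2 := rfl

/-- A linear lift of U need not consist of eigenvectors of `b` and `c`. Applying `proj k p` corrects
this, and the lift stays a lift because `proj k p` fixes U; the universal property of `Fr` then
extends it. -/
theorem exists_section (h2 : (2 : k) ≠ 0) (f : X →ₗ[D4 k] Fr k p U) (hf : Function.Surjective f) :
    ∃ h : Fr k p U →ₗ[D4 k] X, f ∘ₗ h = LinearMap.id := by
  obtain ⟨s, hs⟩ := (f.restrictScalars k).exists_rightInverse_of_surjective
    (LinearMap.range_eq_top.2 hf)
  replace hs : ∀ x, f (s x) = x := LinearMap.congr_fun hs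
  let φ : U →ₗ[k] X := Algebra.lsmul k k _ (proj k p) ∘ₗ s ∘ₗ (RepMod.of _).toLinearMap ∘ₗ
    LinearMap.inl k U (U × U × U)
  have hb : ∀ u, gen k .b • φ u = sgn k p • φ u := fun u => b_smul_proj_smul _ _
  have hc : ∀ u, gen k .c • φ u = sgn k p • φ u := fun u => c_smul_proj_smul _ _
  refine ⟨lift φ hb hc, hom_ext fun u => ?_⟩
  have : proj k p • RepMod.of (freeRep k p U) (u, 0, 0, 0) = RepMod.of _ (u, 0, 0, 0) :=
    proj_smul h2 p (by simp [RepMod.smul_of, freeRep_b, ← map_smul])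
      (by simp [RepMod.smul_of, freeRep_c, ← map_smul])
  have hφ : f (φ u) = RepMod.of _ (u, 0, 0, 0) := by
    change f (proj k p • s (RepMod.of _ (u, 0, 0, 0))) = _
    rw [map_smul, hs, this]
  simp [lift_of, hφ]

theorem projective (h2 : (2 : k) ≠ 0) : Module.Projective (D4 k) (Fr k p U) :=
  Module.Projective.of_lifting_property'' fun f hf => exists_section h2 f hf

/-- The homomorphism into `Fr k p U` with a given component along `ad`. -/
noncomputable def colift (μ : X →ₗ[k] U) (hb : ∀ x, μ (gen k .b • x) = sgn k p • μ x)
    (hc : ∀ x, μ (gen k .c • x) = sgn k p • μ x) : X →ₗ[D4 k] Fr k p U :=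
  homOfGen
    ((RepMod.of (freeRep k p U)).toLinearMap ∘ₗ
    -- The component along `ad` determines the others: the `ad` components of `am`, `dm` and `adm`
    -- are the `d` component, minus the `a` component and the `1` component of `m`.
    { toFun := fun x => (μ (gen k .a • gen k .d • x), -μ (gen k .d • x), μ (gen k .a • x), μ x)
      map_add' := fun m n => by simp [add_comm]
      map_smul' := fun c m => by simp [smul_algebra_smul_comm] }) (by
    intro g x
    have hda : ∀ x, μ (gen k .d • gen k .a • x) = -μ (gen k .a • gen k .d • x) := fun x => by
      rw [da_smul, map_sub, map_sub, hb, hc]; simp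
    have hbd : ∀ x : X, gen k .d • gen k .b • x = -(gen k .b • gen k .d • x) := db_smul
    have hab : ∀ x : X, gen k .a • gen k .b • x = -(gen k .b • gen k .a • x) := fun x => by
      rw [ba_smul, neg_neg]
    have hac : ∀ x : X, gen k .a • gen k .c • x = -(gen k .c • gen k .a • x) := fun x => by
      rw [ca_smul, neg_neg]
    have hada : ∀ x, μ (gen k .a • gen k .d • gen k .a • x) = 0 := fun x => by
      rw [← neg_eq_iff_eq_neg.2 (hda _)]; simp
    cases g <;>
      simp [RepMod.smul_of, freeRep_a, freeRep_b, freeRep_c, freeRep_d, hda, hada, hb, hc,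
        hab, hac, hbd, dc_smul])

/-- The module is cofree as well as free: a homomorphism into it amounts to its `ad` component. That
component is extended linearly, after composing with `proj k p` to make it compatible with `b` and
`c`. -/
theorem injective (h2 : (2 : k) ≠ 0) : Module.Injective (D4 k) (Fr k p U) where
  out X Y _ _ _ _ i hi g := by
    let _ := Module.restrictScalars k (D4 k) X
    let _ := Module.restrictScalars k (D4 k) Y
    have := IsScalarTower.restrictScalars k (D4 k) X
    have := IsScalarTower.restrictScalars k (D4 k) Y
    obtain ⟨q, hq⟩ := LinearMap.exists_leftInverse_of_injective (i.restrictScalars k)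
      (LinearMap.ker_eq_bot.2 hi)
    replace hq : ∀ x, q (i x) = x := LinearMap.congr_fun hq
    let pr : Fr k p U →ₗ[k] U := LinearMap.snd k U U ∘ₗ LinearMap.snd k U (U × U) ∘ₗ
      LinearMap.snd k U (U × U × U) ∘ₗ (RepMod.of _).symm.toLinearMap
    -- The `ad` component already has the right parity, so inserting `proj k p` does not change it
    -- on the image of `i`.
    have hpr : ∀ x, pr (proj k p • x) = pr x := fun x => by
      have hb : ∀ y, pr (gen k .b • y) = sgn k p • pr y := fun y => by
        obtain ⟨m, rfl⟩ := (RepMod.of _).surjective y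
        simp [pr, RepMod.smul_of, freeRep_b]
      have hc : ∀ y, pr (gen k .c • y) = sgn k p • pr y := fun y => by
        obtain ⟨m, rfl⟩ := (RepMod.of _).surjective y
        simp [pr, RepMod.smul_of, freeRep_c]
      have h4 : (4⁻¹ : k) * (2 * 2) = 1 := by
        rw [show (2 * 2 : k) = 4 by norm_num]
        exact inv_mul_cancel₀ (by
          rw [show (4 : k) = 2 * 2 by norm_num]; exact mul_ne_zero h2 h2)
      have h22 : pr x + pr x + (pr x + pr x) = (2 * 2 : k) • pr x := by
        rw [mul_smul, two_smul, two_smul]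
      simp only [proj, smul_assoc, mul_smul, add_smul, one_smul, map_smul, map_add, hb, hc,
        sgn_smul_sgn_smul, h22]
      rw [smul_smul, smul_smul, mul_assoc, h4, one_smul]
    let g' : X →ₗ[k] Fr k p U := g.restrictScalars k
    let μ : Y →ₗ[k] U := pr ∘ₗ g' ∘ₗ q ∘ₗ Algebra.lsmul k k _ (proj k p)
    refine ⟨colift μ (fun y => ?_) (fun y => ?_), fun x => ?_⟩
    · simp [μ, proj_smul_b_smul]
    · simp [μ, proj_smul_c_smul]
    · have hμ : ∀ x, μ (i x) = pr (g x) := fun x => by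
        change pr (g (q (proj k p • i x))) = _
        rw [← map_smul, hq, map_smul, hpr]
      change RepMod.of _ (μ (gen k .a • gen k .d • i x), -μ (gen k .d • i x),
        μ (gen k .a • i x), μ (i x)) = _
      simp only [← map_smul, hμ]
      obtain ⟨m, hm⟩ := (RepMod.of _).surjective (g x)
      simp [map_smul, ← hm, pr, RepMod.smul_of, freeRep_a, freeRep_d]

theorem finrank_eq [Module.Finite k U] : Module.finrank k (Fr k p U) = 4 * Module.finrank k U := by
  rw [RepMod.finrank_eq]
  simp; ring

/-- Homomorphisms between the modules `Fr k p U` induced by linear equivalences. -/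
noncomputable def congr {U' : Type u} [AddCommGroup U'] [Module k U'] (e : U ≃ₗ[k] U') :
    Fr k p U ≃ₗ[D4 k] Fr k p U' :=
  RepMod.equiv (e.prodCongr (e.prodCongr (e.prodCongr e))) fun g m => by
    cases g <;> simp [freeRep_a, freeRep_b, freeRep_c, freeRep_d]

theorem pi_equiv (n : ℕ) : Nonempty (Fr k p (Fin n → k) ≃ₗ[D4 k] (Fin n → Fr k p k)) := by
  let F : Fr k p (Fin n → k) →ₗ[D4 k] (Fin n → Fr k p k) := LinearMap.pi fun i =>
    RepMod.hom ((LinearMap.proj i).prodMap ((LinearMap.proj i).prodMap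
      ((LinearMap.proj i).prodMap (LinearMap.proj i)))) fun g m => by
        cases g <;> simp [freeRep_a, freeRep_b, freeRep_c, freeRep_d]
  refine ⟨LinearEquiv.ofBijective F ⟨?_, fun y => ?_⟩⟩
  · rw [← LinearMap.ker_eq_bot, LinearMap.ker_eq_bot']
    intro x hx
    obtain ⟨⟨u, v, w, z⟩, rfl⟩ := (RepMod.of _).surjective x
    have h : ∀ i, (u i, v i, w i, z i) = 0 := fun i => congrFun hx i
    simp only [Prod.mk_eq_zero] at h
    rw [(funext fun i => (h i).1 : u = 0), (funext fun i => (h i).2.1 : v = 0),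
      (funext fun i => (h i).2.2.1 : w = 0), (funext fun i => (h i).2.2.2 : z = 0)]
    rfl
  · choose m hm using fun i => (RepMod.of _).surjective (y i)
    exact ⟨RepMod.of _ (fun i => (m i).1, fun i => (m i).2.1, fun i => (m i).2.2.1,
      fun i => (m i).2.2.2), funext fun i => hm i⟩

/-- The kernel lies in the span of the images of `a` and `d`, so `eq_top_of_top` makes it
superfluous. -/
theorem isProjectiveCover (h2 : (2 : k) ≠ 0) {N : Type u} [AddCommGroup N] [Module (D4 k) N]
    (f : Fr k p U →ₗ[D4 k] N) (hf : Function.Surjective f)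
    (hk : ∀ m, f (RepMod.of _ m) = 0 → m.1 = 0) : IsProjectiveCover f where
  projective := projective h2
  surjective := hf
  superfluous W hW := eq_top_of_top bc_smul_eq W fun x => by
    obtain ⟨w, hw, y, hy, rfl⟩ := Submodule.mem_sup.1 (hW ▸ Submodule.mem_top : x ∈ W ⊔ _)
    obtain ⟨⟨p, q, r, s⟩, rfl⟩ := (RepMod.of _).surjective y
    have : p = 0 := hk _ hy
    subst this
    refine ⟨w, hw, RepMod.of _ (q, 0, s, 0), RepMod.of _ (r, 0, 0, 0), ?_⟩
    rw [add_assoc]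
    simp [RepMod.smul_of, freeRep_a, freeRep_d, ← map_add]

/-- The vectors of `Fr` killed by `a` and `d` are exactly its `ad` component; a range that contains
them meets every nonzero submodule. -/
theorem isInjectiveEnvelope (h2 : (2 : k) ≠ 0) {N : Type u} [AddCommGroup N] [Module (D4 k) N]
    (f : N →ₗ[D4 k] Fr k p U) (hf : Function.Injective f)
    (hr : ∀ z, ∃ n, f n = RepMod.of _ (0, 0, 0, z)) : IsInjectiveEnvelope f where
  injective_module := injective h2
  injective := hf
  essential W hW := eq_bot_of_socle bc_smul_eq W fun x hx ha hd => by
    have : x ∈ W ⊓ LinearMap.range f := by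
      refine ⟨hx, ?_⟩
      obtain ⟨⟨p, q, r, s⟩, rfl⟩ := (RepMod.of _).surjective x
      simp only [RepMod.smul_of, freeRep_a, freeRep_d, map_eq_zero_iff _ (RepMod.of _).injective,
        Prod.mk_eq_zero, neg_eq_zero] at ha hd
      rw [ha.2.1, ha.2.2.2, hd.2.2.2]
      exact hr s
    rw [hW] at this
    simpa using this

end Fr

end Free

/-! ### Kronecker modules, the simple modules and their projective covers -/

section Kronecker

variable (p : ZMod 2) {U W : Type u} [AddCommGroup U] [Module k U] [AddCommGroup W] [Module k W]
  (A D : U →ₗ[k] W)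

/-- The representation on `U × W` in which `a` and `d` act by the maps `A` and `D` from `U` to `W`,
and `b` and `c` act on `U` by `sgn k p`. -/
noncomputable def kroneckerRep : D4 k →ₐ[k] Module.End k (U × W) :=
  gradedRep
    { toFun := fun m => (sgn k p • m.1, -(sgn k p • m.2))
      map_add' := fun m n => by simp [add_comm]
      map_smul' := fun c m => by simp [smul_comm c] }
    { toFun := fun m => (0, A m.1)
      map_add' := fun m n => by simp
      map_smul' := fun c m => by simp }
    { toFun := fun m => (0, D m.1)
      map_add' := fun m n => by simp
      map_smul' := fun c m => by simp }
    (LinearMap.ext fun m => by simp)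
    (LinearMap.ext fun m => by simp)
    (LinearMap.ext fun m => by simp)
    (LinearMap.ext fun m => by simp)
    (LinearMap.ext fun m => by simp)
    (LinearMap.ext fun m => by simp)

/-- The module of the representation `kroneckerRep p A D`. -/
abbrev Kr : Type u := RepMod (kroneckerRep p A D)

variable {p A D}

theorem kroneckerRep_a (m : U × W) : kroneckerRep p A D (gen k .a) m = (0, A m.1) := by
  simp [kroneckerRep, gradedRep]
theorem kroneckerRep_d (m : U × W) : kroneckerRep p A D (gen k .d) m = (0, D m.1) := by
  simp [kroneckerRep, gradedRep]
theorem kroneckerRep_b (m : U × W) : kroneckerRep p A D (gen k .b) m =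
    (sgn k p • m.1, -(sgn k p • m.2)) := by
  simp [kroneckerRep, gradedRep]
theorem kroneckerRep_c (m : U × W) : kroneckerRep p A D (gen k .c) m =
    (sgn k p • m.1, -(sgn k p • m.2)) := by
  simp [kroneckerRep, gradedRep]

theorem Kr.bc_smul_eq (x : Kr p A D) : gen k .b • gen k .c • x = x := by
  obtain ⟨m, rfl⟩ := (RepMod.of _).surjective x
  simp [RepMod.smul_of, kroneckerRep_b, kroneckerRep_c]

theorem Kr.finrank_eq [Module.Finite k U] [Module.Finite k W] :
    Module.finrank k (Kr p A D) = Module.finrank k U + Module.finrank k W := by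
  rw [RepMod.finrank_eq, Module.finrank_prod]

variable (k) in
theorem charRep_gen (r : ZMod 2) (g : D4Gen) (x : k) :
    (Algebra.lmul k k).comp (D4.lift (charGen k r) (respects_charGen k r)) (gen k g) x =
      charGen k r g * x := by simp

theorem charGen_b (r : ZMod 2) : charGen k r .b = sgn k r := rfl
theorem charGen_c (r : ZMod 2) : charGen k r .c = sgn k r := rfl

/-- The simple module `V(r)` as a module concentrated in the target of a pair of maps. -/
theorem V_equiv_right [Subsingleton U] (hW : Module.finrank k W = 1) (r : ZMod 2) :
    Nonempty (V k r ≃ₗ[D4 k] Kr (r + 1) A D) := by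
  have : Module.Finite k W := Module.finite_of_finrank_eq_succ hW
  let e : k ≃ₗ[k] W := LinearEquiv.ofFinrankEq k W (by rw [hW, Module.finrank_self])
  have hA : A = 0 := Subsingleton.elim _ _
  have hD : D = 0 := Subsingleton.elim _ _
  refine ⟨RepMod.ofRepEquiv.trans (RepMod.equiv (LinearEquiv.ofBijective
    (LinearMap.inr k U W ∘ₗ e.toLinearMap) ⟨LinearMap.inr_injective.comp e.injective, fun m =>
      ⟨e.symm m.2, Prod.ext (Subsingleton.elim _ _) (by simp)⟩⟩) fun g x => ?_)⟩
  rw [charRep_gen, ← smul_eq_mul, map_smul]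
  refine Prod.ext (Subsingleton.elim _ _) ?_
  cases g <;> simp [charGen.eq_1, charGen.eq_4, charGen_b, charGen_c, kroneckerRep_a,
    kroneckerRep_b, kroneckerRep_c, kroneckerRep_d, hA, hD]

/-- The simple module `V(r)` as a module concentrated in the source of a pair of maps. -/
theorem V_equiv_left [Subsingleton W] (hU : Module.finrank k U = 1) (r : ZMod 2) :
    Nonempty (V k r ≃ₗ[D4 k] Kr r A D) := by
  have : Module.Finite k U := Module.finite_of_finrank_eq_succ hU
  let e : k ≃ₗ[k] U := LinearEquiv.ofFinrankEq k U (by rw [hU, Module.finrank_self])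
  have hA : A = 0 := Subsingleton.elim _ _
  have hD : D = 0 := Subsingleton.elim _ _
  refine ⟨RepMod.ofRepEquiv.trans (RepMod.equiv (LinearEquiv.ofBijective
    (LinearMap.inl k U W ∘ₗ e.toLinearMap) ⟨LinearMap.inl_injective.comp e.injective, fun m =>
      ⟨e.symm m.1, Prod.ext (by simp) (Subsingleton.elim _ _)⟩⟩) fun g x => ?_)⟩
  rw [charRep_gen, ← smul_eq_mul, map_smul]
  refine Prod.ext ?_ (Subsingleton.elim _ _)
  cases g <;> simp [charGen.eq_1, charGen.eq_4, charGen_b, charGen_c, kroneckerRep_a,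
    kroneckerRep_b, kroneckerRep_c, kroneckerRep_d]

/-- The module `Fr k p k` is the projective cover of `V(p)`. -/
theorem P_equiv (h2 : (2 : k) ≠ 0) (p : ZMod 2) : Nonempty (Fr k p k ≃ₗ[D4 k] P k p) := by
  obtain ⟨e⟩ := V_equiv_left (k := k) (A := (0 : k →ₗ[k] PUnit.{u + 1})) (D := 0)
    (Module.finrank_self k) p
  let f : Fr k p k →ₗ[D4 k] Kr p (0 : k →ₗ[k] PUnit.{u + 1}) 0 :=
    RepMod.hom (LinearMap.inl k k PUnit.{u + 1} ∘ₗ LinearMap.fst k k (k × k × k)) fun g m => by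
      refine Prod.ext ?_ rfl
      cases g <;> simp [freeRep_a, freeRep_b, freeRep_c, freeRep_d, kroneckerRep_a, kroneckerRep_b,
        kroneckerRep_c, kroneckerRep_d]
  have hf : IsProjectiveCover f := Fr.isProjectiveCover h2 f
    (RepMod.hom_surjective fun x => ⟨(x.1, 0, 0, 0), rfl⟩) fun m hm => congrArg Prod.fst hm
  obtain ⟨E, -⟩ := hf.exists_equiv (isProjectiveCover_projCoverMap (V k p)) e.symm
  exact ⟨E⟩

/-- The module `Fr k p U` is a sum of copies of `P(p)`. -/
theorem Fr.equiv_pi_P (h2 : (2 : k) ≠ 0) (p : ZMod 2) (U : Type u) [AddCommGroup U] [Module k U]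
    [Module.Finite k U] {n : ℕ} (hn : Module.finrank k U = n) :
    Nonempty (Fr k p U ≃ₗ[D4 k] (Fin n → P k p)) := by
  obtain ⟨e⟩ := P_equiv h2 p
  obtain ⟨e'⟩ := Fr.pi_equiv (k := k) (p := p) n
  exact ⟨(Fr.congr (LinearEquiv.ofFinrankEq U (Fin n → k) (by simp [hn]))).trans
    (e'.trans (LinearEquiv.piCongrRight fun _ => e))⟩

end Kronecker

end D4

/-! ### One syzygy or cosyzygy step for Kronecker modules -/

namespace D4

variable {k : Type u} [Field k]

/-- An inclusion of subspaces of complementary dimensions is an equality. -/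
theorem range_eq_ker {K M N : Type*} [AddCommGroup K] [Module k K] [AddCommGroup M] [Module k M]
    [AddCommGroup N] [Module k N] [Module.Finite k M] {i : K →ₗ[k] M} {f : M →ₗ[k] N}
    (hi : Function.Injective i) (hf : Function.Surjective f) (h : ∀ x, f (i x) = 0)
    (hd : Module.finrank k K + Module.finrank k N = Module.finrank k M) :
    LinearMap.range i = LinearMap.ker f := by
  refine Submodule.eq_of_le_of_finrank_eq ?_ ?_
  · rintro _ ⟨x, rfl⟩
    exact h x
  · have := f.finrank_range_add_finrank_ker
    rw [LinearMap.range_eq_top.2 hf, finrank_top] at this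
    rw [LinearMap.finrank_range_of_inj hi]
    omega

section Steps

variable {U U' W : Type u} [AddCommGroup U] [Module k U] [AddCommGroup U'] [Module k U']
  [AddCommGroup W] [Module k W] [Module.Finite k U] [Module.Finite k U'] [Module.Finite k W]
  {A D : U →ₗ[k] W} {A' D' : U' →ₗ[k] U}

/-- The kernel of the cover `Fr k p U` consists of the vectors (0, v, w, z) with Av + Dw = 0. The
pairs (D'x, -A'x) solve this equation, and the dimension hypothesis says that there are no other
solutions. The free coordinate z becomes the new target space, and the parity shifts by one. -/
theorem syzygy_kr (h2 : (2 : k) ≠ 0) {M : FGModuleCat.{u} (D4 k)} {p : ZMod 2}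
    (e : M ≃ₗ[D4 k] Kr p A D) (hD : Function.Surjective D) (hAD : ∀ x, A (D' x) = D (A' x))
    (hinj : ∀ x, A' x = 0 → D' x = 0 → x = 0)
    (hd : Module.finrank k U' + Module.finrank k W = 2 * Module.finrank k U) :
    Nonempty (syzygy M ≃ₗ[D4 k] Kr (p + 1) A' D') := by
  let f₀ : (U × U × U × U) →ₗ[k] U × W :=
    { toFun := fun m => (m.1, A m.2.1 + D m.2.2.1)
      map_add' := fun m n => by simp [add_add_add_comm]
      map_smul' := fun c m => by simp }
  -- With these signs `a` and `d` act on the image through `A'` and `D'` themselves; the sign in the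
  -- last coordinate absorbs the one from `da = -ad`.
  let i₀ : U' × U →ₗ[k] (U × U × U × U) :=
    { toFun := fun m => (0, D' m.1, -A' m.1, -m.2)
      map_add' := fun m n => by simp [add_comm]
      map_smul' := fun c m => by simp }
  let f : Fr k p U →ₗ[D4 k] Kr p A D := RepMod.hom f₀ fun g m => by
    cases g <;> simp [f₀, freeRep_a, freeRep_b, freeRep_c, freeRep_d, kroneckerRep_a,
      kroneckerRep_b, kroneckerRep_c, kroneckerRep_d, add_comm]
  let i : Kr (p + 1) A' D' →ₗ[D4 k] Fr k p U := RepMod.hom i₀ fun g m => by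
    cases g <;> simp [i₀, freeRep_a, freeRep_b, freeRep_c, freeRep_d, kroneckerRep_a,
      kroneckerRep_b, kroneckerRep_c, kroneckerRep_d]
  have hf : Function.Surjective f := RepMod.hom_surjective fun ⟨l, m⟩ => by
    obtain ⟨m', rfl⟩ := hD m
    exact ⟨(l, 0, m', 0), by simp [f₀]⟩
  have hi : Function.Injective i := RepMod.hom_injective <| by
    rw [← LinearMap.ker_eq_bot, LinearMap.ker_eq_bot']
    rintro ⟨l, m⟩ h
    simp only [i₀, LinearMap.coe_mk, AddHom.coe_mk, Prod.mk_eq_zero, neg_eq_zero] at h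
    rw [hinj l h.2.2.1 h.2.1, h.2.2.2, Prod.mk_zero_zero]
  refine syzygy_equiv e (Fr.isProjectiveCover h2 f hf fun m hm => congrArg Prod.fst hm) i hi ?_
  have := range_eq_ker (i := i.restrictScalars k) (f := f.restrictScalars k) hi hf (fun m => by
    refine Prod.ext rfl ?_
    obtain ⟨m, rfl⟩ := (RepMod.of _).surjective m
    change A (D' m.1) + D (-A' m.1) = 0
    rw [map_neg, hAD, add_neg_cancel]) (by
      rw [Kr.finrank_eq, Kr.finrank_eq, Fr.finrank_eq]
      omega)
  exact SetLike.coe_injective (congrArg SetLike.coe this :)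

/-- The same sequence read from the left: U is the `ad` component of the envelope, and the middle
coordinates modulo the pairs (-D'x, A'x) become W through (v, w) ↦ Av + Dw. -/
theorem cosyzygy_kr (h2 : (2 : k) ≠ 0) {M : FGModuleCat.{u} (D4 k)} {p : ZMod 2}
    (e : M ≃ₗ[D4 k] Kr p A' D') (hD : Function.Injective D') (hAD : ∀ x, A (D' x) = D (A' x))
    (hsurj : ∀ y, ∃ u v, A u + D v = y)
    (hd : Module.finrank k U' + Module.finrank k W = 2 * Module.finrank k U) :
    Nonempty (cosyzygy M ≃ₗ[D4 k] Kr (p + 1) A D) := by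
  let i₀ : U' × U →ₗ[k] (U × U × U × U) :=
    { toFun := fun m => (0, -D' m.1, A' m.1, m.2)
      map_add' := fun m n => by simp [add_comm]
      map_smul' := fun c m => by simp }
  let f₀ : (U × U × U × U) →ₗ[k] U × W :=
    { toFun := fun m => (m.1, A m.2.1 + D m.2.2.1)
      map_add' := fun m n => by simp [add_add_add_comm]
      map_smul' := fun c m => by simp }
  let i : Kr p A' D' →ₗ[D4 k] Fr k (p + 1) U := RepMod.hom i₀ fun g m => by
    cases g <;> simp [i₀, freeRep_a, freeRep_b, freeRep_c, freeRep_d, kroneckerRep_a,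
      kroneckerRep_b, kroneckerRep_c, kroneckerRep_d]
  let f : Fr k (p + 1) U →ₗ[D4 k] Kr (p + 1) A D := RepMod.hom f₀ fun g m => by
    cases g <;> simp [f₀, freeRep_a, freeRep_b, freeRep_c, freeRep_d, kroneckerRep_a,
      kroneckerRep_b, kroneckerRep_c, kroneckerRep_d, add_comm]
  have hf : Function.Surjective f := RepMod.hom_surjective fun ⟨l, m⟩ => by
    obtain ⟨q, r, rfl⟩ := hsurj m
    exact ⟨(l, q, r, 0), by simp [f₀]⟩
  have hi : Function.Injective i := RepMod.hom_injective <| by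
    rw [← LinearMap.ker_eq_bot, LinearMap.ker_eq_bot']
    rintro ⟨l, m⟩ h
    simp only [i₀, LinearMap.coe_mk, AddHom.coe_mk, Prod.mk_eq_zero, neg_eq_zero] at h
    rw [(map_eq_zero_iff _ hD).1 h.2.1, h.2.2.2, Prod.mk_zero_zero]
  refine cosyzygy_equiv e (Fr.isInjectiveEnvelope h2 i hi fun z => ⟨RepMod.of _ (0, z), ?_⟩) f hf ?_
  · rw [RepMod.hom_of]; simp [i₀]
  have := range_eq_ker (i := i.restrictScalars k) (f := f.restrictScalars k) hi hf (fun m => by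
    refine Prod.ext rfl ?_
    obtain ⟨m, rfl⟩ := (RepMod.of _).surjective m
    change A (-D' m.1) + D (A' m.1) = 0
    rw [map_neg, hAD, neg_add_cancel]) (by
      rw [Kr.finrank_eq, Kr.finrank_eq, Fr.finrank_eq]
      omega)
  exact SetLike.coe_injective (congrArg SetLike.coe this :)

end Steps

/-! ### Polynomials of bounded degree as binary forms -/

section Polynomials

open Polynomial

variable (k)

/-- The polynomials of degree less than `n`; by homogenization, the binary forms of degree
`n - 1`. -/
def Forms (n : ℕ) : Type u := degreeLT k n

namespace Forms

variable (n : ℕ)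

noncomputable instance : AddCommGroup (Forms k n) := inferInstanceAs (AddCommGroup (degreeLT k n))
noncomputable instance : Module k (Forms k n) := inferInstanceAs (Module k (degreeLT k n))

instance : Module.Finite k (Forms k n) := Module.Finite.equiv (degreeLTEquiv k n).symm

@[simp] theorem finrank_eq : Module.finrank k (Forms k n) = n :=
  (degreeLTEquiv k n).finrank_eq.trans (by simp)

instance : Subsingleton (Forms k 0) :=
  Module.finrank_zero_iff.1 (finrank_eq k 0)

/-- The underlying polynomial. -/
noncomputable def val : Forms k n →ₗ[k] k[X] := (degreeLT k n).subtype

variable {k n}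

theorem val_injective : Function.Injective (val k n) := Subtype.val_injective

theorem val_mem (p : Forms k n) : val k n p ∈ degreeLT k n := Subtype.property _

/-- Linear maps to `Forms k n` from linear maps to polynomials. -/
noncomputable def lift {M : Type*} [AddCommMonoid M] [Module k M] (f : M →ₗ[k] k[X])
    (h : ∀ x, f x ∈ degreeLT k n) : M →ₗ[k] Forms k n :=
  f.codRestrict (degreeLT k n) h

@[simp] theorem val_lift {M : Type*} [AddCommMonoid M] [Module k M] (f : M →ₗ[k] k[X])
    (h : ∀ x, f x ∈ degreeLT k n) (x : M) : val k n (lift f h x) = f x := rfl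

/-- The form given by a polynomial. -/
def mk (p : k[X]) (h : p ∈ degreeLT k n) : Forms k n := ⟨p, h⟩

@[simp] theorem val_mk (p : k[X]) (h : p ∈ degreeLT k n) : val k n (mk p h) = p := rfl

end Forms

/-- Degrees at most a - 1 and b - 1 add up to at most a + b - 2, which explains the bound c + 1. -/
theorem mul_mem_degreeLT {a b c : ℕ} (h : a + b ≤ c + 1) {p q : k[X]} (hp : p ∈ degreeLT k a)
    (hq : q ∈ degreeLT k b) : p * q ∈ degreeLT k c := by
  rcases eq_or_ne p 0 with rfl | hp0
  · simp
  rcases eq_or_ne q 0 with rfl | hq0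
  · simp
  rw [mem_degreeLT] at *
  rw [degree_eq_natDegree hp0, Nat.cast_lt] at hp
  rw [degree_eq_natDegree hq0, Nat.cast_lt] at hq
  rw [degree_mul, degree_eq_natDegree hp0, degree_eq_natDegree hq0]
  exact_mod_cast (by omega : p.natDegree + q.natDegree < c)

/-- The multiplication of forms. -/
noncomputable def mulForms {a b c : ℕ} (h : a + b ≤ c + 1) :
    Forms k a →ₗ[k] Forms k b →ₗ[k] Forms k c :=
  LinearMap.mk₂ k
    (fun p q => Forms.mk (Forms.val k a p * Forms.val k b q)
      (mul_mem_degreeLT k h p.val_mem q.val_mem))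
    (fun p p' q => Forms.val_injective (by
      rw [map_add (Forms.val k c)]; simp only [Forms.val_mk, map_add, add_mul]))
    (fun r p q => Forms.val_injective (by
      rw [map_smul (Forms.val k c)]; simp only [Forms.val_mk, map_smul, smul_mul_assoc]))
    (fun p q q' => Forms.val_injective (by
      rw [map_add (Forms.val k c)]; simp only [Forms.val_mk, map_add, mul_add]))
    (fun r p q => Forms.val_injective (by
      rw [map_smul (Forms.val k c)]; simp only [Forms.val_mk, map_smul, mul_smul_comm]))

@[simp] theorem val_mulForms {a b c : ℕ} (h : a + b ≤ c + 1) (p : Forms k a) (q : Forms k b) :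
    Forms.val k c (mulForms k h p q) = Forms.val k a p * Forms.val k b q := by
  rw [mulForms, LinearMap.mk₂_apply, Forms.val_mk]

/-- The inclusion of the polynomials of degree less than `n` in those of degree less than
`n + 1`. -/
noncomputable def incl (n : ℕ) : Forms k n →ₗ[k] Forms k (n + 1) :=
  Forms.lift (Forms.val k n) fun p => degreeLT_mono n.le_succ p.val_mem

theorem X_mem_degreeLT : X ∈ degreeLT k 2 := by
  rw [mem_degreeLT, degree_X]; norm_num

/-- Multiplication by the variable. -/
noncomputable def mulX (n : ℕ) : Forms k n →ₗ[k] Forms k (n + 1) :=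
  Forms.lift (LinearMap.mulLeft k X ∘ₗ Forms.val k n) fun p =>
    mul_mem_degreeLT k (by omega) (X_mem_degreeLT k) p.val_mem

variable {k}

@[simp] theorem val_incl (n : ℕ) (p : Forms k n) :
    Forms.val k _ (incl k n p) = Forms.val k _ p :=
  Forms.val_lift _ _ _
@[simp] theorem val_mulX (n : ℕ) (p : Forms k n) :
    Forms.val k _ (mulX k n p) = X * Forms.val k _ p :=
  Forms.val_lift _ _ _

theorem incl_injective (n : ℕ) : Function.Injective (incl k n) := fun p q h =>
  Forms.val_injective (by simpa using congrArg (Forms.val k _) h)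

theorem mulX_injective (n : ℕ) : Function.Injective (mulX k n) := fun p q h =>
  Forms.val_injective (by simpa using congrArg (Forms.val k _) h)

theorem mulX_incl (n : ℕ) (p : Forms k n) :
    mulX k (n + 1) (incl k n p) = incl k (n + 1) (mulX k n p) :=
  Forms.val_injective (by simp)

/-- Division by X with constant remainder. This is exactness at the right end of 0 → F_n → F_{n+1}²
→ F_{n+2} → 0; transposed, it gives the injectivity needed for syzygies. -/
theorem exists_mulX_add_incl (n : ℕ) (p : Forms k (n + 2)) :
    ∃ q r : Forms k (n + 1), mulX k _ q + incl k _ r = p := by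
  have hp := p.val_mem
  set P := Forms.val k (n + 2) p with hP
  have hq : P.divX ∈ degreeLT k (n + 1) := by
    rw [mem_degreeLT]
    rcases eq_or_ne P 0 with h0 | h0
    · rw [h0, divX_zero, degree_zero]
      exact WithBot.bot_lt_coe _
    rw [mem_degreeLT, degree_eq_natDegree h0] at hp
    have hp' : P.natDegree < n + 2 := by exact_mod_cast hp
    refine degree_le_natDegree.trans_lt ?_
    rw [natDegree_divX_eq_natDegree_tsub_one]
    exact_mod_cast (by omega : P.natDegree - 1 < n + 1)
  have hr : C (P.coeff 0) ∈ degreeLT k (n + 1) := by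
    rw [mem_degreeLT]
    exact degree_C_le.trans_lt (by exact_mod_cast n.succ_pos)
  refine ⟨Forms.mk _ hq, Forms.mk _ hr, Forms.val_injective ?_⟩
  rw [map_add, val_mulX, val_incl, Forms.val_mk, Forms.val_mk, ← hP, X_mul_divX_add]

end Polynomials

/-! ### Explicit models of the iterated syzygies and cosyzygies of the simple modules -/

variable (k) in
/-- The model of the syzygies of the simple modules. -/
abbrev PosKr (p : ZMod 2) (s : ℕ) : Type u := Kr p (mulX k s).dualMap (incl k s).dualMap

variable (k) in
/-- The model of the cosyzygies of the simple modules. -/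
abbrev NegKr (p : ZMod 2) (t : ℕ) : Type u := Kr p (mulX k t) (incl k t)

theorem finrank_posKr (p : ZMod 2) (s : ℕ) : Module.finrank k (PosKr k p s) = 2 * s + 1 := by
  rw [Kr.finrank_eq, Subspace.dual_finrank_eq, Subspace.dual_finrank_eq, Forms.finrank_eq,
    Forms.finrank_eq]
  omega

theorem finrank_negKr (p : ZMod 2) (t : ℕ) : Module.finrank k (NegKr k p t) = 2 * t + 1 := by
  rw [Kr.finrank_eq, Forms.finrank_eq, Forms.finrank_eq]
  omega

/-- The sequence 0 → F_s → F_{s+1}² → F_{s+2} → 0 is dualized: multiplications by 1 and X commute,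
they jointly reach F_{s+2}, and s + (s + 2) = 2(s + 1). -/
theorem syzygy_posKr (h2 : (2 : k) ≠ 0) {M : FGModuleCat.{u} (D4 k)} {p : ZMod 2} {s : ℕ}
    (e : M ≃ₗ[D4 k] PosKr k p s) : Nonempty (syzygy M ≃ₗ[D4 k] PosKr k (p + 1) (s + 1)) := by
  refine syzygy_kr h2 e (LinearMap.dualMap_surjective_of_injective (incl_injective (k := k) s))
    (fun l => LinearMap.ext fun x => ?_) (fun l h1 h2 => LinearMap.ext fun x => ?_) ?_
  · simp [mulX_incl]
  · obtain ⟨q, r, rfl⟩ := exists_mulX_add_incl s x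
    have h1' := LinearMap.congr_fun h1 q
    have h2' := LinearMap.congr_fun h2 r
    simp only [LinearMap.dualMap_apply] at h1' h2'
    simp [h1', h2']
  · simp only [Subspace.dual_finrank_eq, Forms.finrank_eq]
    omega

theorem cosyzygy_negKr (h2 : (2 : k) ≠ 0) {M : FGModuleCat.{u} (D4 k)} {p : ZMod 2} {t : ℕ}
    (e : M ≃ₗ[D4 k] NegKr k p t) : Nonempty (cosyzygy M ≃ₗ[D4 k] NegKr k (p + 1) (t + 1)) := by
  refine cosyzygy_kr h2 e (incl_injective t) (mulX_incl t) (exists_mulX_add_incl t) ?_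
  simp only [Forms.finrank_eq]
  omega

theorem syzygy_iterate_V (h2 : (2 : k) ≠ 0) (r : ZMod 2) (s : ℕ) :
    Nonempty (syzygy^[s] (V k r) ≃ₗ[D4 k] PosKr k (r + s) s) := by
  induction s with
  | zero =>
    rw [Nat.cast_zero, add_zero]
    exact V_equiv_left (by simp) r
  | succ s ih =>
    obtain ⟨e⟩ := ih
    rw [Function.iterate_succ_apply', Nat.cast_succ, ← add_assoc]
    exact syzygy_posKr h2 e

/-- The extra 1 in the index arises at t = 0: there the source F_0 vanishes and V(r) sits in the
target, whose parity is opposite to the index. -/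
theorem cosyzygy_iterate_V (h2 : (2 : k) ≠ 0) (r : ZMod 2) (t : ℕ) :
    Nonempty (cosyzygy^[t] (V k r) ≃ₗ[D4 k] NegKr k (r + t + 1) t) := by
  induction t with
  | zero =>
    rw [Nat.cast_zero, add_zero]
    exact V_equiv_right (by simp) r
  | succ s ih =>
    obtain ⟨e⟩ := ih
    rw [Function.iterate_succ_apply', Nat.cast_succ, ← add_assoc]
    exact cosyzygy_negKr h2 e

end D4

/-! ### Tensor products of Kronecker modules: the four blocks and the splitting of free summands -/

namespace D4

variable {k : Type u} [Field k]

namespace Kr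

variable {U W : Type u} [AddCommGroup U] [Module k U] [AddCommGroup W] [Module k W]
  (p : ZMod 2) (A D : U →ₗ[k] W)

/-- The inclusion of `U`. -/
noncomputable def inl : U →ₗ[k] Kr p A D := (RepMod.of _).toLinearMap ∘ₗ LinearMap.inl k U W

/-- The inclusion of `W`. -/
noncomputable def inr : W →ₗ[k] Kr p A D := (RepMod.of _).toLinearMap ∘ₗ LinearMap.inr k U W

/-- The projection to `U`. -/
noncomputable def fst : Kr p A D →ₗ[k] U := LinearMap.fst k U W ∘ₗ (RepMod.of _).symm.toLinearMap

/-- The projection to `W`. -/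
noncomputable def snd : Kr p A D →ₗ[k] W := LinearMap.snd k U W ∘ₗ (RepMod.of _).symm.toLinearMap

variable {p A D}

@[simp] theorem fst_inl (u : U) : fst p A D (inl p A D u) = u := rfl
@[simp] theorem snd_inl (u : U) : snd p A D (inl p A D u) = 0 := rfl
@[simp] theorem fst_inr (w : W) : fst p A D (inr p A D w) = 0 := rfl
@[simp] theorem snd_inr (w : W) : snd p A D (inr p A D w) = w := rfl

theorem inl_fst_add_inr_snd (x : Kr p A D) : inl p A D (fst p A D x) + inr p A D (snd p A D x) = x :=
  Prod.ext (add_zero _) (zero_add _)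

@[simp] theorem a_smul_inl (u : U) : gen k .a • inl p A D u = inr p A D (A u) :=
  congrArg (RepMod.of _) (kroneckerRep_a _)
@[simp] theorem d_smul_inl (u : U) : gen k .d • inl p A D u = inr p A D (D u) :=
  congrArg (RepMod.of _) (kroneckerRep_d _)
@[simp] theorem a_smul_inr (w : W) : gen k .a • inr p A D w = 0 :=
  (congrArg (RepMod.of _) (kroneckerRep_a _)).trans (Prod.ext rfl (map_zero A))
@[simp] theorem d_smul_inr (w : W) : gen k .d • inr p A D w = 0 :=
  (congrArg (RepMod.of _) (kroneckerRep_d _)).trans (Prod.ext rfl (map_zero D))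
@[simp] theorem b_smul_inl (u : U) : gen k .b • inl p A D u = sgn k p • inl p A D u :=
  (congrArg (RepMod.of _) (kroneckerRep_b _)).trans (Prod.ext rfl
    (by change -(sgn k p • (0 : W)) = sgn k p • (0 : W); simp))
@[simp] theorem c_smul_inl (u : U) : gen k .c • inl p A D u = sgn k p • inl p A D u :=
  (congrArg (RepMod.of _) (kroneckerRep_c _)).trans (Prod.ext rfl
    (by change -(sgn k p • (0 : W)) = sgn k p • (0 : W); simp))
@[simp] theorem b_smul_inr (w : W) : gen k .b • inr p A D w = -(sgn k p • inr p A D w) :=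
  (congrArg (RepMod.of _) (kroneckerRep_b _)).trans (Prod.ext
    (by change sgn k p • (0 : U) = -(sgn k p • (0 : U)); simp) rfl)
@[simp] theorem c_smul_inr (w : W) : gen k .c • inr p A D w = -(sgn k p • inr p A D w) :=
  (congrArg (RepMod.of _) (kroneckerRep_c _)).trans (Prod.ext
    (by change sgn k p • (0 : U) = -(sgn k p • (0 : U)); simp) rfl)

/-- The homomorphism out of `Kr p A D` given by linear maps on `U` and `W`. -/
noncomputable def lift {X : Type*} [AddCommGroup X] [Module k X] [Module (D4 k) X]
    [IsScalarTower k (D4 k) X] (f : U →ₗ[k] X) (g : W →ₗ[k] X)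
    (fa : ∀ u, gen k .a • f u = g (A u)) (fd : ∀ u, gen k .d • f u = g (D u))
    (fb : ∀ u, gen k .b • f u = sgn k p • f u) (fc : ∀ u, gen k .c • f u = sgn k p • f u)
    (ga : ∀ w, gen k .a • g w = 0) (gd : ∀ w, gen k .d • g w = 0)
    (gb : ∀ w, gen k .b • g w = -(sgn k p • g w)) (gc : ∀ w, gen k .c • g w = -(sgn k p • g w)) :
    Kr p A D →ₗ[D4 k] X :=
  homOfGen (f ∘ₗ fst p A D + g ∘ₗ snd p A D) fun x m => by
    obtain ⟨u, w, rfl⟩ : ∃ u w, inl p A D u + inr p A D w = m := ⟨_, _, inl_fst_add_inr_snd m⟩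
    cases x <;> simp [fa, fb, fc, fd, ga, gb, gc, gd]

end Kr

section KroneckerTensor

variable {U W U' W' : Type u} [AddCommGroup U] [Module k U] [AddCommGroup W] [Module k W]
  [AddCommGroup U'] [Module k U'] [AddCommGroup W'] [Module k W']
  (p q : ZMod 2) (A D : U →ₗ[k] W) (A' D' : U' →ₗ[k] W')

/-- The tensor product of two modules `Kr`. -/
abbrev KrTensor : Type u := RepMod (tensorRep k (Kr p A D) (Kr q A' D'))

namespace KrTensor

/-- The inclusion of `U ⊗ U'`. -/
noncomputable def inUU : U ⊗[k] U' →ₗ[k] KrTensor p q A D A' D' :=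
  (RepMod.of _).toLinearMap ∘ₗ TensorProduct.map (Kr.inl p A D) (Kr.inl q A' D')

/-- The inclusion of `U ⊗ W'`. -/
noncomputable def inUW : U ⊗[k] W' →ₗ[k] KrTensor p q A D A' D' :=
  (RepMod.of _).toLinearMap ∘ₗ TensorProduct.map (Kr.inl p A D) (Kr.inr q A' D')

/-- The inclusion of `W ⊗ U'`. -/
noncomputable def inWU : W ⊗[k] U' →ₗ[k] KrTensor p q A D A' D' :=
  (RepMod.of _).toLinearMap ∘ₗ TensorProduct.map (Kr.inr p A D) (Kr.inl q A' D')

/-- The inclusion of `W ⊗ W'`. -/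
noncomputable def inWW : W ⊗[k] W' →ₗ[k] KrTensor p q A D A' D' :=
  (RepMod.of _).toLinearMap ∘ₗ TensorProduct.map (Kr.inr p A D) (Kr.inr q A' D')

/-- The projection to `U ⊗ W'`. -/
noncomputable def prUW : KrTensor p q A D A' D' →ₗ[k] U ⊗[k] W' :=
  TensorProduct.map (Kr.fst p A D) (Kr.snd q A' D') ∘ₗ
  (RepMod.of _).symm.toLinearMap

/-- The projection to `W ⊗ U'`. -/
noncomputable def prWU : KrTensor p q A D A' D' →ₗ[k] W ⊗[k] U' :=
  TensorProduct.map (Kr.snd p A D) (Kr.fst q A' D') ∘ₗ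
  (RepMod.of _).symm.toLinearMap

/-- The projection to `W ⊗ W'`. -/
noncomputable def prWW : KrTensor p q A D A' D' →ₗ[k] W ⊗[k] W' :=
  TensorProduct.map (Kr.snd p A D) (Kr.snd q A' D') ∘ₗ
  (RepMod.of _).symm.toLinearMap

variable {p q A D A' D'}

theorem inUU_tmul (x : U) (y : U') : inUU p q A D A' D' (x ⊗ₜ y) =
    RepMod.of _ (Kr.inl p A D x ⊗ₜ Kr.inl q A' D' y) := rfl
theorem inUW_tmul (x : U) (y : W') : inUW p q A D A' D' (x ⊗ₜ y) =
    RepMod.of _ (Kr.inl p A D x ⊗ₜ Kr.inr q A' D' y) := rfl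
theorem inWU_tmul (x : W) (y : U') : inWU p q A D A' D' (x ⊗ₜ y) =
    RepMod.of _ (Kr.inr p A D x ⊗ₜ Kr.inl q A' D' y) := rfl
theorem inWW_tmul (x : W) (y : W') : inWW p q A D A' D' (x ⊗ₜ y) =
    RepMod.of _ (Kr.inr p A D x ⊗ₜ Kr.inr q A' D' y) := rfl

/-- The term `a ⊗ b` of the comultiplication brings in the eigenvalue of `b` on the second factor:
`sgn k q` on U', and its negative on W' in the formulas for `inUW`. -/
theorem a_smul_inUU (z : U ⊗[k] U') : gen k .a • inUU p q A D A' D' z =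
    sgn k q • inWU p q A D A' D' (A.rTensor U' z) + inUW p q A D A' D' (A'.lTensor U z) := by
  induction z with
  | zero => simp
  | add x y hx hy => simp only [map_add, smul_add, hx, hy]; abel
  | tmul x y =>
    simp [inUU_tmul, inWU_tmul, inUW_tmul, RepMod.smul_of, tensorRep_gen_a]

theorem d_smul_inUU (z : U ⊗[k] U') : gen k .d • inUU p q A D A' D' z =
    sgn k q • inWU p q A D A' D' (D.rTensor U' z) + inUW p q A D A' D' (D'.lTensor U z) := by
  induction z with
  | zero => simp
  | add x y hx hy => simp only [map_add, smul_add, hx, hy]; abel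
  | tmul x y =>
    simp [inUU_tmul, inWU_tmul, inUW_tmul, RepMod.smul_of, tensorRep_gen_d]

theorem b_smul_inUU (z : U ⊗[k] U') : gen k .b • inUU p q A D A' D' z =
    sgn k (p + q) • inUU p q A D A' D' z := by
  induction z with
  | zero => simp
  | add x y hx hy => simp only [map_add, smul_add, hx, hy]
  | tmul x y =>
    simp [inUU_tmul, RepMod.smul_of, tensorRep_gen_b, sgn_add,
      mul_comm (sgn k p), mul_smul, ← TensorProduct.smul_tmul']

theorem c_smul_inUU (z : U ⊗[k] U') : gen k .c • inUU p q A D A' D' z =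
    sgn k (p + q) • inUU p q A D A' D' z := by
  induction z with
  | zero => simp
  | add x y hx hy => simp only [map_add, smul_add, hx, hy]
  | tmul x y =>
    simp [inUU_tmul, RepMod.smul_of, tensorRep_gen_c, sgn_add,
      mul_comm (sgn k p), mul_smul, ← TensorProduct.smul_tmul']

theorem a_smul_inUW (z : U ⊗[k] W') : gen k .a • inUW p q A D A' D' z =
    -(sgn k q • inWW p q A D A' D' (A.rTensor W' z)) := by
  induction z with
  | zero => simp
  | add x y hx hy => simp only [map_add, smul_add, hx, hy, neg_add]
  | tmul x y =>
    simp [inWW_tmul, inUW_tmul, RepMod.smul_of, tensorRep_gen_a, TensorProduct.tmul_neg]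

theorem d_smul_inUW (z : U ⊗[k] W') : gen k .d • inUW p q A D A' D' z =
    -(sgn k q • inWW p q A D A' D' (D.rTensor W' z)) := by
  induction z with
  | zero => simp
  | add x y hx hy => simp only [map_add, smul_add, hx, hy, neg_add]
  | tmul x y =>
    simp [inWW_tmul, inUW_tmul, RepMod.smul_of, tensorRep_gen_d, TensorProduct.tmul_neg]

theorem b_smul_inUW (z : U ⊗[k] W') : gen k .b • inUW p q A D A' D' z =
    -(sgn k (p + q) • inUW p q A D A' D' z) := by
  induction z with
  | zero => simp
  | add x y hx hy => simp only [map_add, smul_add, hx, hy, neg_add]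
  | tmul x y =>
    simp [inUW_tmul, RepMod.smul_of, tensorRep_gen_b, sgn_add,
      mul_comm (sgn k p), mul_smul, ← TensorProduct.smul_tmul',
      TensorProduct.tmul_neg]

theorem c_smul_inUW (z : U ⊗[k] W') : gen k .c • inUW p q A D A' D' z =
    -(sgn k (p + q) • inUW p q A D A' D' z) := by
  induction z with
  | zero => simp
  | add x y hx hy => simp only [map_add, smul_add, hx, hy, neg_add]
  | tmul x y =>
    simp [inUW_tmul, RepMod.smul_of, tensorRep_gen_c, sgn_add,
      mul_comm (sgn k p), mul_smul, ← TensorProduct.smul_tmul',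
      TensorProduct.tmul_neg]

theorem a_smul_inWU (z : W ⊗[k] U') : gen k .a • inWU p q A D A' D' z =
    inWW p q A D A' D' (A'.lTensor W z) := by
  induction z with
  | zero => simp
  | add x y hx hy => simp only [map_add, smul_add, hx, hy]
  | tmul x y =>
    simp [inWW_tmul, inWU_tmul, RepMod.smul_of, tensorRep_gen_a]

theorem d_smul_inWU (z : W ⊗[k] U') : gen k .d • inWU p q A D A' D' z =
    inWW p q A D A' D' (D'.lTensor W z) := by
  induction z with
  | zero => simp
  | add x y hx hy => simp only [map_add, smul_add, hx, hy]
  | tmul x y =>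
    simp [inWW_tmul, inWU_tmul, RepMod.smul_of, tensorRep_gen_d]

theorem b_smul_inWU (z : W ⊗[k] U') : gen k .b • inWU p q A D A' D' z =
    -(sgn k (p + q) • inWU p q A D A' D' z) := by
  induction z with
  | zero => simp
  | add x y hx hy => simp only [map_add, smul_add, hx, hy, neg_add]
  | tmul x y =>
    simp [inWU_tmul, RepMod.smul_of, tensorRep_gen_b, sgn_add,
      mul_comm (sgn k p), mul_smul, ← TensorProduct.smul_tmul',
      TensorProduct.neg_tmul]

theorem c_smul_inWU (z : W ⊗[k] U') : gen k .c • inWU p q A D A' D' z =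
    -(sgn k (p + q) • inWU p q A D A' D' z) := by
  induction z with
  | zero => simp
  | add x y hx hy => simp only [map_add, smul_add, hx, hy, neg_add]
  | tmul x y =>
    simp [inWU_tmul, RepMod.smul_of, tensorRep_gen_c, sgn_add,
      mul_comm (sgn k p), mul_smul, ← TensorProduct.smul_tmul',
      TensorProduct.neg_tmul]

@[simp] theorem prUW_inUW (z : U ⊗[k] W') : prUW p q A D A' D' (inUW p q A D A' D' z) = z := by
  induction z with
  | zero => simp
  | add x y hx hy => simp only [map_add, hx, hy]
  | tmul x y => simp [inUW_tmul, prUW]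

@[simp] theorem prUW_inWU (z : W ⊗[k] U') : prUW p q A D A' D' (inWU p q A D A' D' z) = 0 := by
  induction z with
  | zero => simp
  | add x y hx hy => simp only [map_add, hx, hy, add_zero]
  | tmul x y => simp [inWU_tmul, prUW]

@[simp] theorem prUW_inWW (z : W ⊗[k] W') : prUW p q A D A' D' (inWW p q A D A' D' z) = 0 := by
  induction z with
  | zero => simp
  | add x y hx hy => simp only [map_add, hx, hy, add_zero]
  | tmul x y => simp [inWW_tmul, prUW]

@[simp] theorem prWW_inUW (z : U ⊗[k] W') : prWW p q A D A' D' (inUW p q A D A' D' z) = 0 := by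
  induction z with
  | zero => simp
  | add x y hx hy => simp only [map_add, hx, hy, add_zero]
  | tmul x y => simp [inUW_tmul, prWW]

@[simp] theorem prWW_inWW (z : W ⊗[k] W') : prWW p q A D A' D' (inWW p q A D A' D' z) = z := by
  induction z with
  | zero => simp
  | add x y hx hy => simp only [map_add, hx, hy]
  | tmul x y => simp [inWW_tmul, prWW]

variable (A D A' D') in
/-- Up to sign, the action of `ad` as a map from `U ⊗ U'` to `W ⊗ W'`. -/
noncomputable def wedge : U ⊗[k] U' →ₗ[k] W ⊗[k] W' :=
  TensorProduct.map D A' - TensorProduct.map A D'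

/-- The paths through W ⊗ U' and U ⊗ W' carry opposite signs, because `c` acts on U' by `sgn k q`
and `b` acts on W' by its negative; hence the difference in `wedge`. -/
theorem ad_smul_inUU (z : U ⊗[k] U') : gen k .a • gen k .d • inUU p q A D A' D' z =
    sgn k q • inWW p q A D A' D' (wedge A D A' D' z) := by
  rw [d_smul_inUU, smul_add, smul_algebra_smul_comm, a_smul_inWU, a_smul_inUW, ← sub_eq_add_neg,
    ← smul_sub, ← map_sub]
  congr 2
  rw [wedge, LinearMap.sub_apply, ← LinearMap.lTensor_comp_rTensor, ← LinearMap.rTensor_comp_lTensor]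
  rfl

/-- The homomorphism from a module `Fr` given by vectors of `U ⊗ U'`. -/
noncomputable def frHom {V : Type u} [AddCommGroup V] [Module k V] (φ : V →ₗ[k] U ⊗[k] U') :
    Fr k (p + q) V →ₗ[D4 k] KrTensor p q A D A' D' :=
  Fr.lift (inUU p q A D A' D' ∘ₗ φ) (fun _ => b_smul_inUU _) fun _ => c_smul_inUU _

/-- Injectivity of `frHom` can be tested on this component, so it reduces to injectivity of `wedge`
composed with `φ`. -/
theorem frHom_socle {V : Type u} [AddCommGroup V] [Module k V] (φ : V →ₗ[k] U ⊗[k] U') (z : V) :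
    frHom (p := p) (q := q) (A := A) (D := D) (A' := A') (D' := D') φ (RepMod.of _ (0, 0, 0, z)) =
      sgn k q • inWW p q A D A' D' (wedge A D A' D' (φ z)) := by
  rw [← ad_smul_inUU, frHom, Fr.lift_of]
  simp

theorem finrank_eq [Module.Finite k U] [Module.Finite k W] [Module.Finite k U']
    [Module.Finite k W'] : Module.finrank k (KrTensor p q A D A' D') =
      (Module.finrank k U + Module.finrank k W) * (Module.finrank k U' + Module.finrank k W') := by
  rw [RepMod.finrank_eq, Module.finrank_tensorProduct, Kr.finrank_eq, Kr.finrank_eq]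

variable {U'' W'' : Type u} [AddCommGroup U''] [Module k U''] [AddCommGroup W''] [Module k W'']
  [Module.Finite k U] [Module.Finite k W] [Module.Finite k U'] [Module.Finite k W']
  [Module.Finite k U''] [Module.Finite k W''] {A'' D'' : U'' →ₗ[k] W''}

theorem sgn_ne_zero (p : ZMod 2) : sgn k p ≠ 0 := fun h => by
  simpa [h] using sgn_mul_self (k := k) p

/-- If `ad` is injective on `U ⊗ U'`, then the module that `U ⊗ U'` generates splits off. -/
theorem equiv_of_injective (h2 : (2 : k) ≠ 0) (hw : Function.Injective (wedge A D A' D'))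
    {E : Type u} [AddCommGroup E] [Module k E] [Module (D4 k) E] [IsScalarTower k (D4 k) E]
    [Module.Finite k E] (f : KrTensor p q A D A' D' →ₗ[D4 k] E) (hf : Function.Surjective f)
    (hfU : ∀ z, f (inUU p q A D A' D' z) = 0)
    (hd : Module.finrank k E + 4 * (Module.finrank k U * Module.finrank k U') =
      (Module.finrank k U + Module.finrank k W) * (Module.finrank k U' + Module.finrank k W')) :
    Nonempty (KrTensor p q A D A' D' ≃ₗ[D4 k] E × Fr k (p + q) (U ⊗[k] U')) := by
  let j : Fr k (p + q) (U ⊗[k] U') →ₗ[D4 k] KrTensor p q A D A' D' := frHom LinearMap.id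
  have hj : Function.Injective j := injective_of_socle Fr.bc_smul_eq j fun x hx ha hd => by
    obtain ⟨⟨u, v, w, z⟩, rfl⟩ := (RepMod.of _).surjective x
    simp only [RepMod.smul_of, freeRep_a, freeRep_d, map_eq_zero_iff _ (RepMod.of _).injective,
      Prod.mk_eq_zero, neg_eq_zero] at ha hd
    obtain ⟨-, rfl, -, rfl⟩ := ha
    obtain ⟨-, -, -, rfl⟩ := hd
    rw [frHom_socle] at hx
    have h0 := congrArg (prWW p q A D A' D') hx
    rw [map_smul, prWW_inWW, map_zero, smul_eq_zero_iff_right (sgn_ne_zero q)] at h0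
    rw [show z = 0 from (map_eq_zero_iff _ hw).1 h0]
    simp
  -- The free module is injective, so its embedding has a retraction `g`.
  obtain ⟨g, hg⟩ := (Fr.injective h2).out j hj LinearMap.id
  replace hg : ∀ x, g (j x) = x := hg
  -- As `f` kills the generators U ⊗ U' of the free submodule, a correction by `j` adjusts `g`
  -- without changing `f`; so `f` and `g` together are onto, and equal dimensions give bijectivity.
  have hfj : f ∘ₗ j = 0 := Fr.hom_ext fun z => by
    have : j (RepMod.of _ (z, 0, 0, 0)) = inUU p q A D A' D' z := by
      simp only [j, frHom, Fr.lift_of]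
      simp
    rw [LinearMap.comp_apply, this, hfU, LinearMap.zero_apply]
  have hs : Function.Surjective (f.prod g) := fun ⟨e, x⟩ => by
    obtain ⟨y, rfl⟩ := hf e
    refine ⟨y + j (x - g y), Prod.ext ?_ ?_⟩
    · have := LinearMap.congr_fun hfj (x - g y)
      simpa using this
    · simp [hg]
  refine ⟨LinearEquiv.ofBijective (f.prod g) ⟨?_, hs⟩⟩
  refine (LinearMap.injective_iff_surjective_of_finrank_eq_finrank
    (f := (f.prod g).restrictScalars k) ?_).2 hs
  rw [finrank_eq, Module.finrank_prod, Fr.finrank_eq, Module.finrank_tensorProduct, hd]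

/-- If `ad` maps `U ⊗ U'` onto `W ⊗ W'`, then a free module on `W ⊗ W'` splits off. -/
theorem equiv_of_surjective (hw : Function.Surjective (wedge A D A' D'))
    {E : Type u} [AddCommGroup E] [Module k E] [Module (D4 k) E] [IsScalarTower k (D4 k) E]
    [Module.Finite k E] (hE : ∀ x : E, gen k .b • gen k .c • x = x)
    (f : E →ₗ[D4 k] KrTensor p q A D A' D')
    (hf : ∀ x, gen k .a • x = 0 → gen k .d • x = 0 →
      prUW p q A D A' D' (f x) = 0 → x = 0)
    (hd : Module.finrank k E + 4 * (Module.finrank k W * Module.finrank k W') =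
      (Module.finrank k U + Module.finrank k W) * (Module.finrank k U' + Module.finrank k W')) :
    Nonempty (KrTensor p q A D A' D' ≃ₗ[D4 k] E × Fr k (p + q) (W ⊗[k] W')) := by
  -- Preimages of W ⊗ W' under `wedge` serve as free generators: `ad` sends them back to W ⊗ W', up
  -- to sign.
  obtain ⟨φ, hφ⟩ := (wedge A D A' D').exists_rightInverse_of_surjective
    (LinearMap.range_eq_top.2 hw)
  replace hφ : ∀ x, wedge A D A' D' (φ x) = x := LinearMap.congr_fun hφ
  let j : Fr k (p + q) (W ⊗[k] W') →ₗ[D4 k] KrTensor p q A D A' D' := frHom φ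
  have hi : Function.Injective (f.coprod j) := injective_of_socle
    (fun x => Prod.ext (hE x.1) (Fr.bc_smul_eq x.2)) _ fun ⟨e, x⟩ hx ha hd => by
      obtain ⟨⟨u, v, w, z⟩, rfl⟩ := (RepMod.of _).surjective x
      simp only [Prod.smul_mk, RepMod.smul_of, freeRep_a, freeRep_d, Prod.mk_eq_zero,
        map_eq_zero_iff _ (RepMod.of _).injective, neg_eq_zero] at ha hd
      obtain ⟨ha, -, rfl, -, rfl⟩ := ha
      obtain ⟨hd, -, -, -, rfl⟩ := hd
      rw [LinearMap.coprod_apply, frHom_socle, hφ] at hx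
      -- The socle of the free part lies in W ⊗ W', which `prUW` does not see, so the U ⊗ W'
      -- component isolates `e`.
      have he : e = 0 := hf e ha hd (by simpa using congrArg (prUW p q A D A' D') hx)
      subst he
      have h0 := congrArg (prWW p q A D A' D') hx
      rw [map_zero, zero_add, map_smul, prWW_inWW, map_zero,
        smul_eq_zero_iff_right (sgn_ne_zero q)] at h0
      subst h0
      simp
  refine ⟨(LinearEquiv.ofBijective (f.coprod j) ⟨hi, ?_⟩).symm⟩
  refine (LinearMap.injective_iff_surjective_of_finrank_eq_finrank
    (f := (f.coprod j).restrictScalars k) ?_).1 hi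
  rw [finrank_eq, Module.finrank_prod, Fr.finrank_eq, Module.finrank_tensorProduct, hd]

end KrTensor

end KroneckerTensor

end D4

/-! ### Coordinate formulas, and homomorphisms out of a tensor product -/

namespace D4

variable {k : Type u} [Field k]

namespace Kr

variable {U W : Type u} [AddCommGroup U] [Module k U] [AddCommGroup W] [Module k W]
  {p : ZMod 2} {A D : U →ₗ[k] W}

@[simp] theorem fst_a_smul (x : Kr p A D) : fst p A D (gen k .a • x) = 0 :=
  congrArg Prod.fst (kroneckerRep_a (p := p) (A := A) (D := D) _)
@[simp] theorem snd_a_smul (x : Kr p A D) : snd p A D (gen k .a • x) = A (fst p A D x) :=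
  congrArg Prod.snd (kroneckerRep_a (p := p) (A := A) (D := D) _)
@[simp] theorem fst_d_smul (x : Kr p A D) : fst p A D (gen k .d • x) = 0 :=
  congrArg Prod.fst (kroneckerRep_d (p := p) (A := A) (D := D) _)
@[simp] theorem snd_d_smul (x : Kr p A D) : snd p A D (gen k .d • x) = D (fst p A D x) :=
  congrArg Prod.snd (kroneckerRep_d (p := p) (A := A) (D := D) _)
@[simp] theorem fst_b_smul (x : Kr p A D) : fst p A D (gen k .b • x) = sgn k p • fst p A D x :=
  congrArg Prod.fst (kroneckerRep_b (p := p) (A := A) (D := D) _)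
@[simp] theorem snd_b_smul (x : Kr p A D) : snd p A D (gen k .b • x) = -(sgn k p • snd p A D x) :=
  congrArg Prod.snd (kroneckerRep_b (p := p) (A := A) (D := D) _)
@[simp] theorem fst_c_smul (x : Kr p A D) : fst p A D (gen k .c • x) = sgn k p • fst p A D x :=
  congrArg Prod.fst (kroneckerRep_c (p := p) (A := A) (D := D) _)
@[simp] theorem snd_c_smul (x : Kr p A D) : snd p A D (gen k .c • x) = -(sgn k p • snd p A D x) :=
  congrArg Prod.snd (kroneckerRep_c (p := p) (A := A) (D := D) _)

end Kr

namespace KrTensor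

variable {U W U' W' U'' W'' : Type u} [AddCommGroup U] [Module k U] [AddCommGroup W] [Module k W]
  [AddCommGroup U'] [Module k U'] [AddCommGroup W'] [Module k W']
  [AddCommGroup U''] [Module k U''] [AddCommGroup W''] [Module k W'']
  {p q : ZMod 2} {A D : U →ₗ[k] W} {A' D' : U' →ₗ[k] W'} {A'' D'' : U'' →ₗ[k] W''}

theorem smul_tmul_eq (c : k) (x : U) (y : W) : (c • x) ⊗ₜ[k] y = c • (x ⊗ₜ y) := rfl

theorem prUW_of (x : Kr p A D) (y : Kr q A' D') :
    prUW p q A D A' D' (RepMod.of _ (x ⊗ₜ y)) = Kr.fst p A D x ⊗ₜ Kr.snd q A' D' y := rfl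
theorem prWU_of (x : Kr p A D) (y : Kr q A' D') :
    prWU p q A D A' D' (RepMod.of _ (x ⊗ₜ y)) = Kr.snd p A D x ⊗ₜ Kr.fst q A' D' y := rfl
theorem prWW_of (x : Kr p A D) (y : Kr q A' D') :
    prWW p q A D A' D' (RepMod.of _ (x ⊗ₜ y)) = Kr.snd p A D x ⊗ₜ Kr.snd q A' D' y := rfl

@[simp] theorem prWU_inUW (z : U ⊗[k] W') : prWU p q A D A' D' (inUW p q A D A' D' z) = 0 := by
  induction z with
  | zero => simp
  | add x y hx hy => simp only [map_add, hx, hy, add_zero]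
  | tmul x y => simp [inUW_tmul, prWU_of]

@[simp] theorem prWU_inWW (z : W ⊗[k] W') : prWU p q A D A' D' (inWW p q A D A' D' z) = 0 := by
  induction z with
  | zero => simp
  | add x y hx hy => simp only [map_add, hx, hy, add_zero]
  | tmul x y => simp [inWW_tmul, prWU_of]

theorem wedge_eq_zero_iff (z : U ⊗[k] U') :
    wedge A D A' D' z = 0 ↔ TensorProduct.map D A' z = TensorProduct.map A D' z := by
  rw [wedge, LinearMap.sub_apply, sub_eq_zero]

theorem wedge_injective [Module.Finite k U] [Module.Finite k U']
    (h : Module.finrank k (LinearMap.ker (wedge A D A' D')) = 0) :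
    Function.Injective (wedge A D A' D') := by
  rw [← LinearMap.ker_eq_bot, ← Submodule.finrank_eq_zero (R := k), h]

/-- By rank-nullity, a kernel this small leaves a rank of at least dim W · dim W'. -/
theorem wedge_surjective [Module.Finite k U] [Module.Finite k U'] [Module.Finite k W]
    [Module.Finite k W'] (h : Module.finrank k W * Module.finrank k W' +
      Module.finrank k (LinearMap.ker (wedge A D A' D')) ≤
        Module.finrank k U * Module.finrank k U') :
    Function.Surjective (wedge A D A' D') := by
  rw [← LinearMap.range_eq_top]
  apply Submodule.eq_top_of_finrank_eq
  have h2 := (wedge A D A' D').finrank_range_add_finrank_ker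
  have h3 := (LinearMap.range (wedge A D A' D')).finrank_le
  rw [Module.finrank_tensorProduct] at h2 h3 ⊢
  omega

/-- A homomorphism out of the tensor product given by compatible pairings. -/
theorem exists_surjective_hom (β : U ⊗[k] W' →ₗ[k] U'') (β' : W ⊗[k] U' →ₗ[k] U'')
    (γ : W ⊗[k] W' →ₗ[k] W'') (hβ : Function.Surjective β) (hγ : Function.Surjective γ)
    (h1a : ∀ u u', β (u ⊗ₜ A' u') = β' (A u ⊗ₜ u')) (h1d : ∀ u u', β (u ⊗ₜ D' u') = β' (D u ⊗ₜ u'))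
    (h2a : ∀ u w, A'' (β (u ⊗ₜ w)) = γ (A u ⊗ₜ w)) (h2d : ∀ u w, D'' (β (u ⊗ₜ w)) = γ (D u ⊗ₜ w))
    (h3a : ∀ w u, A'' (β' (w ⊗ₜ u)) = γ (w ⊗ₜ A' u))
    (h3d : ∀ w u, D'' (β' (w ⊗ₜ u)) = γ (w ⊗ₜ D' u)) :
    ∃ f : KrTensor p q A D A' D' →ₗ[D4 k] Kr (p + q + 1) A'' D'', Function.Surjective f ∧
      ∀ z, f (inUU p q A D A' D' z) = 0 := by
  -- The sign before `β'` makes both components of `a • (u ⊗ u')` cancel, so that U ⊗ U' can go to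
  -- zero; the sign before `γ` undoes the one in the action of `a` on U ⊗ W'. The index p + q + 1 is
  -- the parity of U ⊗ W'.
  let L : KrTensor p q A D A' D' →ₗ[k] Kr (p + q + 1) A'' D'' :=
    Kr.inl _ _ _ ∘ₗ (β ∘ₗ prUW p q A D A' D' - sgn k q • (β' ∘ₗ prWU p q A D A' D')) -
      sgn k q • (Kr.inr _ _ _ ∘ₗ γ ∘ₗ prWW p q A D A' D')
  have hL : ∀ g x, L (gen k g • x) = gen k g • L x := by
    intro g x
    have hs : ∀ g (c : k) (x : Kr (p + q + 1) A'' D''),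
        gen k g • c • x = c • gen k g • x := fun g c x => smul_algebra_smul_comm _ _ _
    obtain ⟨x, rfl⟩ := (RepMod.of _).surjective x
    induction x with
    | zero => simp
    | add x y hx hy => simp only [map_add, smul_add, hx, hy]
    | tmul x y =>
      simp only [L, RepMod.smul_of]
      cases g <;>
        simp [tensorRep_gen_a, tensorRep_gen_b, tensorRep_gen_c, tensorRep_gen_d,
          prUW_of, prWU_of, prWW_of, TensorProduct.tmul_neg, TensorProduct.neg_tmul,
          smul_tmul_eq, smul_sub, hs,
          h1a, h1d, h2a, h2d, h3a, h3d]
      · abel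
      · simp [sgn_add, mul_comm (sgn k p), mul_smul]
      · simp [sgn_add, mul_comm (sgn k p), mul_smul]
      · abel
  refine ⟨homOfGen L hL, fun x => ?_, fun z => ?_⟩
  · obtain ⟨u, hu⟩ := hβ (Kr.fst _ _ _ x)
    obtain ⟨w, hw⟩ := hγ (Kr.snd _ _ _ x)
    refine ⟨inUW p q A D A' D' u - sgn k q • inWW p q A D A' D' w, ?_⟩
    rw [← Kr.inl_fst_add_inr_snd x, ← hu, ← hw]
    simp [L]
  · induction z with
    | zero => simp
    | add x y hx hy => rw [map_add, map_add, hx, hy, add_zero]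
    | tmul x y => simp [inUU_tmul, L, prUW_of, prWU_of, prWW_of]

end KrTensor

/-! ### The kernel of `ad`: operators that commute with multiplication by X -/

section Wedge

open Polynomial

/-- Turns identities between tensors into identities between operators, where they can be evaluated
on polynomials. -/
theorem dualTensorHom_map {M M' N N' : Type*} [AddCommGroup M] [Module k M] [AddCommGroup M']
    [Module k M'] [AddCommGroup N] [Module k N] [AddCommGroup N'] [Module k N'] (f : M' →ₗ[k] M)
    (g : N →ₗ[k] N') (z : Module.Dual k M ⊗[k] N) :
    dualTensorHom k M' N' (TensorProduct.map f.dualMap g z) = g ∘ₗ dualTensorHom k M N z ∘ₗ f := by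
  induction z with
  | zero => simp
  | add x y hx hy => simp only [map_add, hx, hy, LinearMap.add_comp, LinearMap.comp_add]
  | tmul x y => ext; simp [dualTensorHom_apply]

/-- The map `wedge` for the tensor product of `PosKr k p s` and `NegKr k q t`. -/
noncomputable abbrev formsWedge (k : Type u) [Field k] (s t : ℕ) :=
  KrTensor.wedge (U := Module.Dual k (Forms k (s + 1))) (W := Module.Dual k (Forms k s))
    (mulX k s).dualMap (incl k s).dualMap (mulX k t) (incl k t)

theorem X_pow_mem_degreeLT {i n : ℕ} (h : i < n) : (X ^ i : k[X]) ∈ degreeLT k n := by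
  rw [mem_degreeLT, degree_X_pow]
  exact_mod_cast h

theorem Forms.hom_ext {n : ℕ} {M : Type*} [AddCommGroup M] [Module k M] {f g : Forms k n →ₗ[k] M}
    (h : ∀ i (hi : i < n), f (Forms.mk (X ^ i) (X_pow_mem_degreeLT hi)) =
      g (Forms.mk (X ^ i) (X_pow_mem_degreeLT hi))) : f = g := by
  have hb : ∀ i, degreeLT.basis k n i = Forms.mk (X ^ (i : ℕ)) (X_pow_mem_degreeLT i.2) := fun i =>
    Subtype.ext (by rw [degreeLT.basis_val]; rfl)
  exact (degreeLT.basis k n).ext fun i => by rw [hb]; exact h i i.2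

theorem Forms.finrank_le_of_injOn {M : Type*} [AddCommGroup M] [Module k M] {n : ℕ}
    (K : Submodule k M) (f : M →ₗ[k] k[X]) (hf : ∀ x ∈ K, f x ∈ degreeLT k n)
    (hi : ∀ x ∈ K, ∀ y ∈ K, f x = f y → x = y) : Module.finrank k K ≤ n := by
  have hf' : ∀ x, (f ∘ₗ K.subtype) x ∈ degreeLT k n := fun x => hf x x.2
  have : Function.Injective (Forms.lift _ hf') := fun x y h => Subtype.ext (hi x x.2 y y.2 (by
    have h' := congrArg (Forms.val k n) h
    rwa [Forms.val_lift, Forms.val_lift] at h'))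
  exact (LinearMap.finrank_le_finrank_of_injective this).trans_eq (Forms.finrank_eq k _)

theorem KrTensor.finrank_ker_wedge_le {U W U' W' : Type u} [AddCommGroup U] [Module k U]
    [AddCommGroup W] [Module k W] [AddCommGroup U'] [Module k U'] [AddCommGroup W'] [Module k W']
    {A D : U →ₗ[k] W} {A' D' : U' →ₗ[k] W'} {n : ℕ} (f : U ⊗[k] U' →ₗ[k] k[X])
    (hf : ∀ z, wedge A D A' D' z = 0 → f z ∈ degreeLT k n)
    (hi : ∀ z, wedge A D A' D' z = 0 → ∀ w, wedge A D A' D' w = 0 → f z = f w → z = w) :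
    Module.finrank k (LinearMap.ker (wedge A D A' D')) ≤ n :=
  Forms.finrank_le_of_injOn _ f hf hi

theorem mem_degreeLT_of_X_pow_mul_mem {s t : ℕ} {g : k[X]} (h : X ^ s * g ∈ degreeLT k t) :
    g ∈ degreeLT k (t - s) := by
  rcases eq_or_ne g 0 with rfl | h0
  · exact Submodule.zero_mem _
  rw [mem_degreeLT, degree_mul, degree_X_pow, degree_eq_natDegree h0] at h
  rw [mem_degreeLT, degree_eq_natDegree h0]
  have : s + g.natDegree < t := by exact_mod_cast h
  exact_mod_cast (by omega : g.natDegree < t - s)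

/-- A tensor killed by `formsWedge` is an operator φ with φ(Xv) = Xφ(v) for v of degree less than s.
By induction it is multiplication by φ(1). -/
theorem val_dualTensorHom_X_pow {s t : ℕ} {z : Module.Dual k (Forms k (s + 1)) ⊗[k] Forms k t}
    (hz : formsWedge k s t z = 0) (i : ℕ) (hi : i < s + 1) :
    Forms.val k t (dualTensorHom k _ _ z (Forms.mk (X ^ i) (X_pow_mem_degreeLT hi))) =
      X ^ i * Forms.val k t (dualTensorHom k _ _ z
        (Forms.mk (X ^ 0) (X_pow_mem_degreeLT s.succ_pos))) := by
  induction i with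
  | zero => simp
  | succ i ih =>
    have h0 := congrArg (dualTensorHom k _ _) ((KrTensor.wedge_eq_zero_iff z).1 hz)
    rw [dualTensorHom_map, dualTensorHom_map] at h0
    have h1 := congrArg (Forms.val k _) (LinearMap.congr_fun h0
      (Forms.mk (X ^ i) (X_pow_mem_degreeLT (by omega))))
    have e1 : incl k s (Forms.mk (X ^ i) (X_pow_mem_degreeLT (by omega))) =
        Forms.mk (X ^ i) (X_pow_mem_degreeLT (by omega)) :=
      Forms.val_injective (by rw [val_incl, Forms.val_mk, Forms.val_mk])
    have e2 : mulX k s (Forms.mk (X ^ i) (X_pow_mem_degreeLT (by omega))) =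
        Forms.mk (X ^ (i + 1)) (X_pow_mem_degreeLT hi) :=
      Forms.val_injective (by rw [val_mulX, Forms.val_mk, Forms.val_mk, pow_succ'])
    simp only [LinearMap.comp_apply, val_mulX, val_incl, e1, e2] at h1
    rw [← h1, ih (by omega), pow_succ', mul_assoc]

/-- Such an operator is determined by φ(1), and X^s φ(1) = φ(X^s) still has degree less than t, so
φ(1) has degree less than t - s. The truncated difference is meant: for t ≤ s nothing is left. -/
theorem finrank_ker_formsWedge_le (s t : ℕ) :
    Module.finrank k (LinearMap.ker (formsWedge k s t)) ≤ t - s := by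
  obtain ⟨ψ, hψ⟩ : ∃ ψ : Module.Dual k (Forms k (s + 1)) ⊗[k] Forms k t →ₗ[k] k[X],
      ∀ z, ψ z = Forms.val k t (dualTensorHom k _ _ z
        (Forms.mk (X ^ 0) (X_pow_mem_degreeLT s.succ_pos))) :=
    ⟨Forms.val k t ∘ₗ LinearMap.applyₗ (Forms.mk (X ^ 0) (X_pow_mem_degreeLT s.succ_pos)) ∘ₗ
      dualTensorHom k _ _, fun z => rfl⟩
  refine KrTensor.finrank_ker_wedge_le ψ
    (fun z hz => mem_degreeLT_of_X_pow_mul_mem (t := t) (s := s) ?_) fun z hz w hw hzw => ?_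
  · rw [hψ, ← val_dualTensorHom_X_pow hz s s.lt_succ_self]
    exact Forms.val_mem _
  · rw [hψ, hψ] at hzw
    have h1 : dualTensorHom k _ _ z = dualTensorHom k _ _ w :=
      Forms.hom_ext fun i hi => Forms.val_injective <| by
        rw [val_dualTensorHom_X_pow hz i hi, val_dualTensorHom_X_pow hw i hi, hzw]
    exact (dualTensorHomEquiv k _ _).injective (by simpa using h1)

theorem formsWedge_injective {s t : ℕ} (h : t ≤ s) : Function.Injective (formsWedge k s t) := by
  apply KrTensor.wedge_injective
  exact Nat.le_zero.1 ((finrank_ker_formsWedge_le (k := k) s t).trans (by omega))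

/-- The bound on the kernel is exactly the difference of dimensions: (s + 1)t - s(t + 1) = t - s. -/
theorem formsWedge_surjective {s t : ℕ} (h : s ≤ t) : Function.Surjective (formsWedge k s t) := by
  apply KrTensor.wedge_surjective
  have h1 := finrank_ker_formsWedge_le (k := k) s t
  rw [Subspace.dual_finrank_eq, Subspace.dual_finrank_eq]
  simp only [Forms.finrank_eq]
  obtain ⟨n, rfl⟩ := Nat.exists_eq_add_of_le h
  rw [Nat.add_sub_cancel_left] at h1
  refine (Nat.add_le_add_left h1 _).trans ?_
  ring_nf
  omega

end Wedge

end D4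

/-! ### Homomorphisms into a tensor product; contraction and multiplication tensors -/

namespace D4

variable {k : Type u} [Field k]

/-- A homomorphism into a tensor product of Kronecker modules from compatible linear maps. -/
theorem KrTensor.exists_hom {U W U' W' U'' W'' : Type u} [AddCommGroup U] [Module k U]
    [AddCommGroup W] [Module k W] [AddCommGroup U'] [Module k U'] [AddCommGroup W'] [Module k W']
    [AddCommGroup U''] [Module k U''] [AddCommGroup W''] [Module k W'']
    {p q : ZMod 2} {A D : U →ₗ[k] W} {A' D' : U' →ₗ[k] W'} {A'' D'' : U'' →ₗ[k] W''}
    (α : U'' →ₗ[k] U ⊗[k] U') (β : W'' →ₗ[k] U ⊗[k] W') (γ : W'' →ₗ[k] W ⊗[k] U')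
    (h1a : ∀ u, A.rTensor U' (α u) = γ (A'' u)) (h1d : ∀ u, D.rTensor U' (α u) = γ (D'' u))
    (h2a : ∀ u, A'.lTensor U (α u) = β (A'' u)) (h2d : ∀ u, D'.lTensor U (α u) = β (D'' u))
    (h3a : ∀ w, A.rTensor W' (β w) = A'.lTensor W (γ w))
    (h3d : ∀ w, D.rTensor W' (β w) = D'.lTensor W (γ w)) :
    ∃ f : Kr (p + q) A'' D'' →ₗ[D4 k] KrTensor p q A D A' D', ∀ x, Kr.fst _ _ _ x = 0 →
      prUW p q A D A' D' (f x) = β (Kr.snd _ _ _ x) := by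
  have hs : ∀ g (c : k) (x : KrTensor p q A D A' D'), gen k g • c • x = c • gen k g • x :=
    fun g c x => smul_algebra_smul_comm _ _ _
  -- The combination of the two blocks is the one produced by `a` and `d` on U ⊗ U'. Its two
  -- contributions to W ⊗ W' cancel by `h3a` and `h3d`.
  let G : W'' →ₗ[k] KrTensor p q A D A' D' :=
    inUW p q A D A' D' ∘ₗ β + sgn k q • (inWU p q A D A' D' ∘ₗ γ)
  have hG : ∀ w, G w = inUW p q A D A' D' (β w) + sgn k q • inWU p q A D A' D' (γ w) :=
    fun w => rfl
  let f : Kr (p + q) A'' D'' →ₗ[D4 k] KrTensor p q A D A' D' :=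
    Kr.lift (inUU p q A D A' D' ∘ₗ α) G
      (fun u => by rw [LinearMap.comp_apply, a_smul_inUU, h1a, h2a, hG, add_comm])
      (fun u => by rw [LinearMap.comp_apply, d_smul_inUU, h1d, h2d, hG, add_comm])
      (fun u => b_smul_inUU _) (fun u => c_smul_inUU _)
      (fun w => by rw [hG, smul_add, hs, a_smul_inUW, a_smul_inWU, h3a, neg_add_cancel])
      (fun w => by rw [hG, smul_add, hs, d_smul_inUW, d_smul_inWU, h3d, neg_add_cancel])
      (fun w => by
        rw [hG, smul_add, hs, b_smul_inUW, b_smul_inWU, smul_neg, smul_comm (sgn k q), ← neg_add,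
          ← smul_add])
      (fun w => by
        rw [hG, smul_add, hs, c_smul_inUW, c_smul_inWU, smul_neg, smul_comm (sgn k q), ← neg_add,
          ← smul_add])
  refine ⟨f, fun x hx => ?_⟩
  have : f x = inUU p q A D A' D' (α (Kr.fst _ _ _ x)) + G (Kr.snd _ _ _ x) := rfl
  rw [this, hx, hG]
  simp

section Pairings

open Polynomial

/-- The constant form `1`. -/
noncomputable def oneForm (k : Type u) [Field k] (n : ℕ) : Forms k (n + 1) :=
  Forms.mk (X ^ 0) (X_pow_mem_degreeLT n.succ_pos)

@[simp] theorem val_oneForm (n : ℕ) : Forms.val k _ (oneForm k n) = 1 := by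
  rw [oneForm, Forms.val_mk, pow_zero]

theorem mulForms_oneForm_injective {a b c : ℕ} (h : (a + 1) + b ≤ c + 1) :
    Function.Injective (mulForms k h (oneForm k a)) := fun p q hpq =>
  Forms.val_injective (by simpa using congrArg (Forms.val k _) hpq)

/-- The contraction of a functional on forms with a form. -/
noncomputable def contraction (k : Type u) [Field k] {a b c : ℕ} (h : b + c ≤ a + 1) :
    Module.Dual k (Forms k a) ⊗[k] Forms k b →ₗ[k] Module.Dual k (Forms k c) :=
  TensorProduct.lift ((LinearMap.llcomp k (Forms k c) (Forms k a) k).compl₂ (mulForms k h))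

/-- Contraction with the form 1 alone suffices: it is the transpose of an injective map. -/
theorem contraction_surjective {a b c : ℕ} (h : (b + 1) + c ≤ a + 1) :
    Function.Surjective (contraction k h) := fun l => by
  obtain ⟨m, hm⟩ := LinearMap.dualMap_surjective_of_injective
    (mulForms_oneForm_injective (k := k) h) l
  exact ⟨m ⊗ₜ oneForm k b, hm⟩

/-- The tensor that corresponds to multiplication by a form. -/
noncomputable def mulTensor (k : Type u) [Field k] {a b c : ℕ} (h : a + b ≤ c + 1) :
    Forms k a →ₗ[k] Module.Dual k (Forms k b) ⊗[k] Forms k c :=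
  (dualTensorHomEquiv k (Forms k b) (Forms k c)).symm.toLinearMap ∘ₗ mulForms k h

theorem dualTensorHom_mulTensor {a b c : ℕ} (h : a + b ≤ c + 1) (p : Forms k a) :
    dualTensorHom k _ _ (mulTensor k h p) = mulForms k h p := by
  exact (dualTensorHomEquiv k (Forms k b) (Forms k c)).apply_symm_apply (mulForms k h p)

theorem dualTensorHom_injective (b c : ℕ) :
    Function.Injective (dualTensorHom k (Forms k b) (Forms k c)) := fun x y h =>
  (dualTensorHomEquiv k _ _).injective (by simpa using h)

/-- Under `dualTensorHom` the tensors are multiplication operators, so compatibility with X and 1 on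
either side reduces to commutativity and associativity of polynomial multiplication. -/
theorem rTensor_mulTensor {a b b' c a' : ℕ} (h : a + b ≤ c + 1) (h' : a' + b' ≤ c + 1)
    (f : Forms k b' →ₗ[k] Forms k b) (p : Forms k a) (p' : Forms k a')
    (hp : ∀ v, Forms.val k a p * Forms.val k b (f v) = Forms.val k a' p' * Forms.val k b' v) :
    f.dualMap.rTensor _ (mulTensor k h p) = mulTensor k h' p' := by
  apply dualTensorHom_injective
  rw [LinearMap.rTensor, dualTensorHom_map, dualTensorHom_mulTensor, dualTensorHom_mulTensor]
  exact LinearMap.ext fun v => Forms.val_injective (by simp [hp])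

theorem lTensor_mulTensor {a b c c' a' : ℕ} (h : a + b ≤ c + 1) (h' : a' + b ≤ c' + 1)
    (f : Forms k c →ₗ[k] Forms k c') (p : Forms k a) (p' : Forms k a')
    (hp : ∀ v, Forms.val k c' (f (mulForms k h p v)) = Forms.val k a' p' * Forms.val k b v) :
    f.lTensor _ (mulTensor k h p) = mulTensor k h' p' := by
  apply dualTensorHom_injective
  have : f.lTensor (Module.Dual k (Forms k b)) = TensorProduct.map
      (LinearMap.id : Forms k b →ₗ[k] Forms k b).dualMap f := by
    rw [LinearMap.dualMap_id]; rfl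
  rw [this, dualTensorHom_map, dualTensorHom_mulTensor, dualTensorHom_mulTensor]
  exact LinearMap.ext fun v => Forms.val_injective (by simp [hp])

end Pairings

/-! ### The two decompositions of the tensor product -/

section PosNeg

/-- All compatibilities express that a factor X may be moved freely between the functional, the form
contracted with it and the argument. -/
theorem posKr_tensor_negKr_of_le (h2 : (2 : k) ≠ 0) (p q : ZMod 2) (t n : ℕ) :
    Nonempty (RepMod (tensorRep k (PosKr k p (t + n)) (NegKr k q t)) ≃ₗ[D4 k]
      PosKr k (p + q + 1) n ×
        Fr k (p + q) (Module.Dual k (Forms k (t + n + 1)) ⊗[k] Forms k t)) := by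
  have hU : (t + 1) + (n + 1) ≤ (t + n + 1) + 1 := by omega
  have hW : t + (n + 1) ≤ (t + n) + 1 := by omega
  have hWW : (t + 1) + n ≤ (t + n) + 1 := by omega
  obtain ⟨f, hf, hf0⟩ := KrTensor.exists_surjective_hom (p := p) (q := q)
    (A := (mulX k (t + n)).dualMap) (D := (incl k (t + n)).dualMap) (A' := mulX k t)
    (D' := incl k t) (A'' := (mulX k n).dualMap) (D'' := (incl k n).dualMap)
    (contraction k hU) (contraction k hW) (contraction k hWW)
    (contraction_surjective hU) (contraction_surjective hWW)
    (fun l v => LinearMap.ext fun w => congrArg l (Forms.val_injective (by simp [mul_assoc])))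
    (fun l v => LinearMap.ext fun w => congrArg l (Forms.val_injective (by simp)))
    (fun l v => LinearMap.ext fun w => congrArg l (Forms.val_injective (by simp [mul_left_comm])))
    (fun l v => LinearMap.ext fun w => congrArg l (Forms.val_injective (by simp)))
    (fun l v => LinearMap.ext fun w => congrArg l (Forms.val_injective (by
      simp [mul_left_comm, mul_assoc])))
    (fun l v => LinearMap.ext fun w => congrArg l (Forms.val_injective (by simp)))
  -- With s = t + n the remaining count is (2n + 1) + 4(s + 1)t = (2s + 1)(2t + 1).
  refine KrTensor.equiv_of_injective h2 (formsWedge_injective (Nat.le_add_right t n)) f hf hf0 ?_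
  rw [finrank_posKr, Subspace.dual_finrank_eq, Subspace.dual_finrank_eq]
  simp only [Forms.finrank_eq]
  ring

/-- The source F_n of the embedded summand consists of the multiplication operators from F_{s+1} to
F_{s+n}, which are the operators found in the kernel of `formsWedge`. -/
theorem posKr_tensor_negKr_of_ge (p q : ZMod 2) (s n : ℕ) :
    Nonempty (RepMod (tensorRep k (PosKr k p s) (NegKr k q (s + n))) ≃ₗ[D4 k]
      NegKr k (p + q) n ×
        Fr k (p + q) (Module.Dual k (Forms k s) ⊗[k] Forms k (s + n + 1))) := by
  have hUU : n + (s + 1) ≤ (s + n) + 1 := by omega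
  have hUW : (n + 1) + (s + 1) ≤ (s + n + 1) + 1 := by omega
  have hWU : (n + 1) + s ≤ (s + n) + 1 := by omega
  have hWW : (n + 2) + s ≤ (s + n + 1) + 1 := by omega
  obtain ⟨f, hf⟩ := KrTensor.exists_hom (p := p) (q := q)
    (A := (mulX k s).dualMap) (D := (incl k s).dualMap) (A' := mulX k (s + n))
    (D' := incl k (s + n)) (A'' := mulX k n) (D'' := incl k n)
    (mulTensor k hUU) (mulTensor k hUW) (mulTensor k hWU)
    (fun u => rTensor_mulTensor hUU hWU _ _ _ fun v => by simp [mul_left_comm, mul_assoc])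
    (fun u => rTensor_mulTensor hUU hWU _ _ _ fun v => by simp)
    (fun u => lTensor_mulTensor hUU hUW _ _ _ fun v => by simp [mul_assoc])
    (fun u => lTensor_mulTensor hUU hUW _ _ _ fun v => by simp)
    (fun w => (rTensor_mulTensor hUW hWW _ _ (mulX k (n + 1) w)
      fun v => by simp [mul_left_comm, mul_assoc]).trans
      (lTensor_mulTensor hWU hWW _ _ (mulX k (n + 1) w) fun v => by simp [mul_assoc]).symm)
    (fun w => (rTensor_mulTensor hUW hWW _ _ (incl k (n + 1) w) fun v => by simp).trans
      (lTensor_mulTensor hWU hWW _ _ (incl k (n + 1) w) fun v => by simp).symm)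
  refine KrTensor.equiv_of_surjective (formsWedge_surjective (Nat.le_add_right s n))
    Kr.bc_smul_eq f (fun x ha _ hx => ?_) ?_
  -- Multiplication by X is injective, so a vector killed by `a` has no component in the source F_n.
  · have hu : Kr.fst _ _ _ x = 0 := mulX_injective n (by
      rw [← Kr.snd_a_smul, ha, map_zero, map_zero])
    have hw : Kr.snd _ _ _ x = 0 := by
      -- A multiplication operator is recovered from its value at 1.
      have h0 : mulForms k hUW (Kr.snd _ _ _ x) (oneForm k s) = 0 := by
        rw [← dualTensorHom_mulTensor, ← hf x hu, hx, map_zero]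
        rfl
      exact Forms.val_injective (by simpa using congrArg (Forms.val k _) h0)
    rw [← Kr.inl_fst_add_inr_snd x, hu, hw, map_zero, map_zero, add_zero]
  · rw [finrank_negKr, Subspace.dual_finrank_eq, Subspace.dual_finrank_eq]
    simp only [Forms.finrank_eq]
    ring

end PosNeg

/-! ### Assembly: integer indices and parities -/

theorem Omega_neg_natCast (t : ℕ) (M : FGModuleCat.{u} (D4 k)) :
    Omega (-(t : ℤ)) M = cosyzygy^[t] M := by
  cases t <;> rfl

/-- The hypothesis `he` treats both parities of s + t at once: its left side is the sum of the index
r + s of the first model and the index r' + t + 1 of the second. -/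
theorem tensor_Omega_of_le (h2 : (2 : k) ≠ 0) (r r' e : ZMod 2) {s t : ℕ} (hts : t ≤ s)
    (he : r + r' + (((s + t : ℕ) : ZMod 2) + 1) = e) :
    Nonempty (tensor (Omega (s : ℤ) (V k r)) (Omega (-(t : ℤ)) (V k r')) ≃ₗ[D4 k]
      (Omega ((s : ℤ) - (t : ℤ)) (V k (r + r')) × (Fin ((s + 1) * t) → P k e))) := by
  obtain ⟨n, rfl⟩ := Nat.exists_eq_add_of_le hts
  rw [Omega_neg_natCast, show ((t + n : ℕ) : ℤ) - (t : ℤ) = (n : ℤ) by push_cast; ring]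
  obtain ⟨e₁⟩ := syzygy_iterate_V h2 r (t + n)
  obtain ⟨e₂⟩ := cosyzygy_iterate_V h2 r' t
  obtain ⟨e₃⟩ := syzygy_iterate_V h2 (r + r') n
  obtain ⟨e₄⟩ := tensor_congr e₁ e₂
  obtain ⟨e₅⟩ := posKr_tensor_negKr_of_le h2 (r + (t + n : ℕ)) (r' + t + 1) t n
  have h22 : (2 : ZMod 2) = 0 := rfl
  -- The index of the non-projective summand agrees with that of the model of Ω^n V(r + r') because
  -- 2(t + 1) = 0 in `ZMod 2`.
  have hp : r + ((t + n : ℕ) : ZMod 2) + (r' + t + 1) + 1 = r + r' + n := by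
    push_cast
    linear_combination (t + 1 : ZMod 2) * h22
  have hq : r + ((t + n : ℕ) : ZMod 2) + (r' + t + 1) = e := by
    rw [← he]; push_cast; ring
  rw [hp, hq] at e₅
  obtain ⟨e₆⟩ := Fr.equiv_pi_P h2 e
    (Module.Dual k (Forms k (t + n + 1)) ⊗[k] Forms k t) (n := (t + n + 1) * t) (by
      rw [Module.finrank_tensorProduct, Subspace.dual_finrank_eq, Forms.finrank_eq,
        Forms.finrank_eq])
  exact ⟨e₄.trans (e₅.trans (e₃.symm.prodCongr e₆))⟩

theorem tensor_Omega_of_ge (h2 : (2 : k) ≠ 0) (r r' e : ZMod 2) {s t : ℕ} (hst : s ≤ t)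
    (he : r + r' + (((s + t : ℕ) : ZMod 2) + 1) = e) :
    Nonempty (tensor (Omega (s : ℤ) (V k r)) (Omega (-(t : ℤ)) (V k r')) ≃ₗ[D4 k]
      (Omega ((s : ℤ) - (t : ℤ)) (V k (r + r')) × (Fin ((t + 1) * s) → P k e))) := by
  obtain ⟨n, rfl⟩ := Nat.exists_eq_add_of_le hst
  rw [Omega_neg_natCast, show (s : ℤ) - ((s + n : ℕ) : ℤ) = -(n : ℤ) by push_cast; ring,
    Omega_neg_natCast]
  obtain ⟨e₁⟩ := syzygy_iterate_V h2 r s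
  obtain ⟨e₂⟩ := cosyzygy_iterate_V h2 r' (s + n)
  obtain ⟨e₃⟩ := cosyzygy_iterate_V h2 (r + r') n
  obtain ⟨e₄⟩ := tensor_congr e₁ e₂
  obtain ⟨e₅⟩ := posKr_tensor_negKr_of_ge (k := k) (r + s) (r' + (s + n : ℕ) + 1) s n
  have h22 : (2 : ZMod 2) = 0 := rfl
  have hp : r + (s : ZMod 2) + (r' + ((s + n : ℕ) : ZMod 2) + 1) = r + r' + n + 1 := by
    push_cast
    linear_combination (s : ZMod 2) * h22
  obtain ⟨e₆⟩ := Fr.equiv_pi_P h2 e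
    (Module.Dual k (Forms k s) ⊗[k] Forms k (s + n + 1)) (n := (s + n + 1) * s) (by
      rw [Module.finrank_tensorProduct, Subspace.dual_finrank_eq, Forms.finrank_eq,
        Forms.finrank_eq, mul_comm])
  have hq : r + r' + n + 1 = e := by
    rw [← he]; push_cast
    linear_combination -(s : ZMod 2) * h22
  rw [hp] at e₅
  rw [← hq] at e₆ ⊢
  exact ⟨e₄.trans (e₅.trans (e₃.symm.prodCongr e₆))⟩

end D4

theorem proposition2p20 {k : Type u} [Field k] [IsAlgClosed k] (hk : ringChar k ≠ 2)
    (r r' : ZMod 2) (s t : ℕ) (hs : 1 ≤ s) (ht : 1 ≤ t) :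
    (Even (s + t) → t ≤ s →
      Nonempty (D4.tensor (D4.Omega (s : ℤ) (D4.V k r)) (D4.Omega (-(t : ℤ)) (D4.V k r'))
        ≃ₗ[D4 k] (D4.Omega ((s : ℤ) - (t : ℤ)) (D4.V k (r + r')) ×
          (Fin ((s + 1) * t) → D4.P k (r + r' + 1))))) ∧
    (Odd (s + t) → t ≤ s →
      Nonempty (D4.tensor (D4.Omega (s : ℤ) (D4.V k r)) (D4.Omega (-(t : ℤ)) (D4.V k r'))
        ≃ₗ[D4 k] (D4.Omega ((s : ℤ) - (t : ℤ)) (D4.V k (r + r')) ×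
          (Fin ((s + 1) * t) → D4.P k (r + r'))))) ∧
    (Even (s + t) → s < t →
      Nonempty (D4.tensor (D4.Omega (s : ℤ) (D4.V k r)) (D4.Omega (-(t : ℤ)) (D4.V k r'))
        ≃ₗ[D4 k] (D4.Omega ((s : ℤ) - (t : ℤ)) (D4.V k (r + r')) ×
          (Fin ((t + 1) * s) → D4.P k (r + r' + 1))))) ∧
    (Odd (s + t) → s < t →
      Nonempty (D4.tensor (D4.Omega (s : ℤ) (D4.V k r)) (D4.Omega (-(t : ℤ)) (D4.V k r'))
        ≃ₗ[D4 k] (D4.Omega ((s : ℤ) - (t : ℤ)) (D4.V k (r + r')) ×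
          (Fin ((t + 1) * s) → D4.P k (r + r'))))) := by
  have h2 : (2 : k) ≠ 0 := Ring.two_ne_zero hk
  have heven : Even (s + t) → r + r' + (((s + t : ℕ) : ZMod 2) + 1) = r + r' + 1 := fun h => by
    rw [(ZMod.natCast_eq_zero_iff_even).2 h, zero_add]
  have hodd : Odd (s + t) → r + r' + (((s + t : ℕ) : ZMod 2) + 1) = r + r' := fun h => by
    rw [(ZMod.natCast_eq_one_iff_odd).2 h, show (1 + 1 : ZMod 2) = 0 from rfl, add_zero]
  exact ⟨fun h hts => D4.tensor_Omega_of_le h2 r r' _ hts (heven h),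
    fun h hts => D4.tensor_Omega_of_le h2 r r' _ hts (hodd h),
    fun h hst => D4.tensor_Omega_of_ge h2 r r' _ hst.le (heven h),
    fun h hst => D4.tensor_Omega_of_ge h2 r r' _ hst.le (hodd h)⟩
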